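/- Let $n\ge 1$. Let $SPD(n)$ be the space of real symmetric positive definite $n\times n$ matrices, and for $S\in SPD(n)$ let $S^{1/2}\in SPD(n)$ denote its positive square root. Let $\mu_{GL(n)}$ be the measure $|\det A|^{-n}\,dA$ on $GL(n,\mathbb R)$, where $dA=\prod_{i,j=1}^n dA_{ij}$ is Lebesgue measure; let $\mu_{SPD}$ be the measure $|\det S|^{-(n+1)/2}\,dS$ on $SPD(n)$, where $dS=\prod_{i\le j}dS_{ij}$; and let $\mu_{O(n)}$, $\mu_{SO(n)}$ be the Haar probability measures of $O(n)$ and $SO(n)$. Let $\mathrm{Vol}(O(n))$ be the Riemannian volume of $O(n)$ for the bi-invariant metric $\langle X,Y\rangle=\tfrac12\operatorname{tr}(X^{T}Y)$ (that is, for the volume form $\bigwedge_{i<j}(R^{T}dR)_{ij}$), and put $\beta_n=\mathrm{Vol}(O(n))/2^n$. Then $\mu_{GL(n)}$ is a Haar measure of $GL(n,\mathbb R)$, its restriction to the group $GL^+(n,\mathbb R)$ of matrices of positive determinant is a Haar measure of $GL^+(n,\mathbb R)$, and $\mu_{SPD}$ is invariant under $S\mapsto ASA^{T}$ for all $A\in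 GL(n,\mathbb R)$. The map $SPD(n)\times O(n)\to GL(n,\mathbb R)$, $(S,R)\mapsto A=S^{1/2}R$, is a bijection, and under it $$d\mu_{GL(n)}(A)=\beta_n\,d\mu_{SPD}(S)\,d\mu_{O(n)}(R),$$ i.e. $\mu_{GL(n)}$ is the image of the measure $\beta_n\,\mu_{SPD}\otimes\mu_{O(n)}$. The map restricts to a bijection $SPD(n)\times SO(n)\to GL^+(n,\mathbb R)$, and for every continuous compactly supported $f:GL^+(n,\mathbb R)\to\mathbb R$ the function $f$ is $\mu_{GL(n)}$-integrable on $GL^+(n,\mathbb R)$, $(S,R)\mapsto f(S^{1/2}R)$ is $\mu_{SPD}\otimes\mu_{SO(n)}$-integrable, and $$\int_{GL^+(n,\mathbb R)}f(A)\,d\mu_{GL(n)}(A)=\frac{\beta_n}{2}\int_{SPD(n)}\int_{SO(n)}f(S^{1/2}R)\,d\mu_{SO(n)}(R)\,d\mu_{SPD}(S).$$ -/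

import Mathlib

open MeasureTheory Matrix
open scoped MatrixOrder MatrixGroups ENNReal

/-- Real `n × n` matrices carry the product (equivalently, Borel) σ-algebra of `ℝ^(n × n)`. -/
instance matrixMeasurableSpace (n : ℕ) : MeasurableSpace (Matrix (Fin n) (Fin n) ℝ) :=
  inferInstanceAs (MeasurableSpace (Fin n → Fin n → ℝ))

instance matrixBorelSpace (n : ℕ) : BorelSpace (Matrix (Fin n) (Fin n) ℝ) :=
  inferInstanceAs (BorelSpace (Fin n → Fin n → ℝ))

/-- The space of real symmetric positive definite `n × n` matrices. -/
abbrev SPD (n : ℕ) : Type := {S : Matrix (Fin n) (Fin n) ℝ // S.PosDef}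

/-- The orthogonal group `O(n)`. -/
abbrev OGroup (n : ℕ) : Type := Matrix.orthogonalGroup (Fin n) ℝ

/-- The special orthogonal group `SO(n)`. -/
abbrev SOGroup (n : ℕ) : Type := Matrix.specialOrthogonalGroup (Fin n) ℝ

/-- The inclusion `SO(n) ⊆ O(n)`. -/
def SOGroup.toO {n : ℕ} (R : SOGroup n) : OGroup n :=
  ⟨R.1, (Matrix.mem_specialOrthogonalGroup_iff.1 R.2).1⟩

/-- The measure `|det A|⁻ⁿ dA` on `GL(n, ℝ)`, where `dA` is the Lebesgue measure
`∏ i j, dA i j` of `ℝ^(n × n)`. -/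
noncomputable def glHaar (n : ℕ) : Measure (GL (Fin n) ℝ) :=
  (Measure.comap (fun (A : GL (Fin n) ℝ) (i j : Fin n) => (A : Matrix (Fin n) (Fin n) ℝ) i j)
    (volume : Measure (Fin n → Fin n → ℝ))).withDensity
      fun A => ENNReal.ofReal (|(A : Matrix (Fin n) (Fin n) ℝ).det| ^ n)⁻¹

/-- The restriction of `|det A|⁻ⁿ dA` to the subgroup `GL⁺(n, ℝ)` of matrices of positive
determinant. -/
noncomputable def glPosHaar (n : ℕ) : Measure (Matrix.GLPos (Fin n) ℝ) :=
  (glHaar n).comap Subtype.val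

/-- The measure `|det S|^(-(n+1)/2) dS` on `SPD(n)`, where `dS = ∏_{i ≤ j} dS i j`. -/
noncomputable def spdMeasure (n : ℕ) : Measure (SPD n) :=
  (Measure.comap (fun (S : SPD n) (p : {p : Fin n × Fin n // p.1 ≤ p.2}) => S.1 p.1.1 p.1.2)
    (volume : Measure ({p : Fin n × Fin n // p.1 ≤ p.2} → ℝ))).withDensity
      fun S => ENNReal.ofReal (|S.1.det| ^ (-((n : ℝ) + 1) / 2))

/-- The action `S ↦ A S Aᵀ` of `GL(n, ℝ)` on `SPD(n)`. -/
def spdAct {n : ℕ} (A : GL (Fin n) ℝ) (S : SPD n) : SPD n :=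
  ⟨(A : Matrix (Fin n) (Fin n) ℝ) * S.1 * (A : Matrix (Fin n) (Fin n) ℝ)ᵀ, by
    have h := S.2.mul_mul_conjTranspose_same (B := (A : Matrix (Fin n) (Fin n) ℝ))
      (Matrix.vecMul_injective_of_isUnit A.isUnit)
    rwa [Matrix.conjTranspose_eq_transpose_of_trivial] at h⟩

theorem det_sqrt_pos {n : ℕ} (S : SPD n) : 0 < (CFC.sqrt S.1).det := by
  have h0 : 0 ≤ S.1 := S.2.posSemidef.nonneg
  have h1 : CFC.sqrt S.1 * CFC.sqrt S.1 = S.1 := CFC.sqrt_mul_sqrt_self S.1 h0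
  have h2 : 0 ≤ (CFC.sqrt S.1).det := (CFC.sqrt_nonneg S.1).posSemidef.det_nonneg
  have h3 : (CFC.sqrt S.1).det * (CFC.sqrt S.1).det = S.1.det := by
    rw [← Matrix.det_mul, h1]
  have h4 : 0 < S.1.det := S.2.det_pos
  rcases h2.eq_or_lt with h | h
  · rw [← h] at h3
    simp at h3
    exact absurd h3 h4.ne
  · exact h

theorem det_orthogonal_ne_zero {n : ℕ} (R : OGroup n) : R.1.det ≠ 0 := by
  have h := congrArg Matrix.det ((Matrix.mem_orthogonalGroup_iff (Fin n) ℝ).1 R.2)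
  rw [Matrix.det_mul, Matrix.det_one] at h
  exact left_ne_zero_of_mul (h ▸ one_ne_zero)

/-- The map `SPD(n) × O(n) → GL(n, ℝ)`, `(S, R) ↦ S^{1/2} R`, where `S^{1/2}` is the positive
square root of `S`. -/
noncomputable def polarMap (n : ℕ) (p : SPD n × OGroup n) : GL (Fin n) ℝ :=
  Matrix.GeneralLinearGroup.mkOfDetNeZero (CFC.sqrt p.1.1 * p.2.1) (by
    rw [Matrix.det_mul]
    exact mul_ne_zero (det_sqrt_pos p.1).ne' (det_orthogonal_ne_zero p.2))

/-- The map `SPD(n) × SO(n) → GL⁺(n, ℝ)`, `(S, R) ↦ S^{1/2} R`. -/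
noncomputable def polarMapPos (n : ℕ) (p : SPD n × SOGroup n) : Matrix.GLPos (Fin n) ℝ :=
  ⟨polarMap n (p.1, p.2.toO), by
    have hR : p.2.1.det = 1 := (Matrix.mem_specialOrthogonalGroup_iff.1 p.2.2).2
    have h : 0 < (CFC.sqrt p.1.1 * p.2.1).det := by
      rw [Matrix.det_mul, hR, mul_one]
      exact det_sqrt_pos p.1
    exact h⟩

/-- `Vol(O(n))`: the total Riemannian volume of `O(n)` for the bi-invariant metric
`⟨X, Y⟩ = tr(Xᵀ Y) / 2`, i.e. for the volume form `⋀_{i < j} (Rᵀ dR)_{ij}`. It is the Euclidean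
(Lebesgue-normalized) Hausdorff measure, in the dimension `n (n - 1) / 2`, of the image of `O(n)`
under `R ↦ R / √2` in the Euclidean space `ℝ^(n × n)`. -/
noncomputable def orthogonalVolume (n : ℕ) : ℝ≥0∞ :=
  μHE[n.choose 2] (Set.range fun R : OGroup n =>
    (WithLp.toLp 2 fun p : Fin n × Fin n => R.1 p.1 p.2 / √2 :
      EuclideanSpace ℝ (Fin n × Fin n)))

/-- The constant `β_n = Vol(O(n)) / 2ⁿ`. -/
noncomputable def polarConstant (n : ℕ) : ℝ≥0∞ := orthogonalVolume n / 2 ^ n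

/-! Polar decomposition turns left multiplication by $A$ into a skew product
$(S,R)\mapsto(ASA^T,\,k(A,S)R)$ with $k(A,S)\in O(n)$ (`glMul_polarMap`). This preserves
$\mu_{SPD}\otimes\mu_{O(n)}$: on the base because $S\mapsto ASA^T$ has determinant $(\det A)^{n+1}$
(`det_congrEnd`), on the fibres because they are translated. Hence the image of the product on
$GL(n)$ is left invariant and finite on compact sets, so by uniqueness of Haar measure it is
$c\,\mu_{GL(n)}$ (`exists_map_polarMap_eq_smul`). No Jacobian of the polar map away from the
identity is needed.

The constant is read off near the identity. With $S=\exp(2Y)$, $Y$ symmetric, and $R=\exp X$, $X$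
skew, the polar map becomes $(Y,X)\mapsto\exp(Y)\exp(X)$, whose derivative at $0$ is $(Y,X)\mapsto
Y+X$. Put $N=n(n-1)/2$. On small cubes, up to factors tending to $1$, $\mu_{SPD}$ is $2^{N+n}$ times
Lebesgue measure in $Y$, the volume of $O(n)$ is Lebesgue measure in $X$, and $\mu_{GL(n)}$ is $2^N$
times Lebesgue measure in $(Y,X)$. Comparing gives $c\,\mathrm{Vol}(O(n))=2^n$, that is
$1/c=\beta_n$ (`smul_const_mul_orthogonalVolume`).

For $GL^+(n)$: $SO(n)$ is open of index two in $O(n)$, so $\mu_{O(n)}$ restricts to $\mu_{SO(n)}/2$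
and the constant is halved (`measurePreserving_polarMapPos`). -/

/-! ### Determinants of linear actions and the densities they preserve. -/

/-- Multiplicative real functions of a matrix are determined on invertible matrices by their
values on diagonal matrices. -/
theorem monoidHom_eq_of_diagonal {n : ℕ} (χ₁ χ₂ : Matrix (Fin n) (Fin n) ℝ →* ℝ)
    (h : ∀ D, χ₁ (diagonal D) = χ₂ (diagonal D)) (M : Matrix (Fin n) (Fin n) ℝ)
    (hM : M.det ≠ 0) : χ₁ M = χ₂ M := by
  have key : ∀ (χ : Matrix (Fin n) (Fin n) ℝ →* ℝ) (i j : Fin n) (_ : i ≠ j) (c : ℝ),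
      χ (transvection i j c) = 1 := by
    intro χ i j hij c
    have hinv : χ (transvection i j c) * χ (transvection i j (-c)) = 1 := by
      rw [← map_mul, transvection_mul_transvection_same i j hij]
      simp
    -- Conjugation by this diagonal matrix doubles the parameter of the transvection, hence squares
    -- the transvection. So $\chi$ of it is an invertible idempotent of $\mathbb R$, which is $1$.
    set d : Fin n → ℝ := Function.update 1 i 2
    set d' : Fin n → ℝ := Function.update 1 i 2⁻¹
    have hdd : diagonal d * diagonal d' = 1 := by
      rw [diagonal_mul_diagonal, ← diagonal_one]
      congr 1
      ext k
      by_cases hk : k = i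
      · subst hk; simp [d, d']
      · simp [d, d', hk]
    have hd : χ (diagonal d) * χ (diagonal d') = 1 := by
      rw [← map_mul, hdd, map_one]
    have hconj : diagonal d * transvection i j c * diagonal d' = transvection i j (c + c) := by
      ext a b
      rw [mul_diagonal, diagonal_mul]
      simp only [transvection, Matrix.add_apply, Matrix.one_apply, Matrix.single_apply]
      by_cases ha : a = i
      · subst ha
        by_cases hb : b = a
        · subst hb; simp [d, d', hij.symm]
        · have hb' : ¬ a = b := fun h => hb h.symm
          by_cases hj : j = b
          · subst hj; simp [d, d', hij, hij.symm]; ring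
          · simp [d, d', hb, hb', hj]
      · have ha' : ¬ i = a := fun h => ha h.symm
        by_cases hb : a = b
        · subst hb; simp [d, d', ha, ha']
        · simp [d, d', ha, ha', hb]
    have h1 := congrArg χ hconj
    rw [← transvection_mul_transvection_same i j hij, map_mul, map_mul, map_mul] at h1
    have h2 : χ (transvection i j c) = χ (transvection i j c) * χ (transvection i j c) := by
      rw [← h1, mul_right_comm, hd, one_mul]
    have h3 : χ (transvection i j c) ≠ 0 := left_ne_zero_of_mul_eq_one hinv
    exact (mul_left_cancel₀ h3 (by rw [mul_one]; exact h2)).symm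
  refine diagonal_transvection_induction_of_det_ne_zero (fun M => χ₁ M = χ₂ M) M hM
    (fun D _ => h D) (fun t => ?_) (fun A B _ _ hA hB => ?_)
  · change χ₁ (transvection _ _ _) = χ₂ (transvection _ _ _)
    rw [key _ _ _ t.hij, key _ _ _ t.hij]
  · simp only [map_mul, hA, hB]

/-- A transformation that is linear in a chart preserves a density that compensates for the
determinant. -/
theorem measurePreserving_withDensity_comap {G E : Type*} [MeasurableSpace G]
    [NormedAddCommGroup E] [NormedSpace ℝ E] [FiniteDimensional ℝ E] [MeasurableSpace E]
    [BorelSpace E] (μ : Measure E) [μ.IsAddHaarMeasure] {ι : G → E} (hι : MeasurableEmbedding ι)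
    (T : G ≃ᵐ G) (L : E →ₗ[ℝ] E) (hL : LinearMap.det L ≠ 0) (hT : ∀ x, ι (T x) = L (ι x))
    {w : G → ℝ≥0∞} (hw : ∀ x, w (T x) * ENNReal.ofReal |LinearMap.det L| = w x) :
    MeasurePreserving T ((μ.comap ι).withDensity w) ((μ.comap ι).withDensity w) := by
  set c := ENNReal.ofReal |LinearMap.det L| with hc
  have hc0 : c ≠ 0 := by simpa [hc] using hL
  have hct : c ≠ ∞ := by simp [hc]
  have hmap : (μ.comap ι).map T = c⁻¹ • μ.comap ι := by
    ext s hs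
    rw [T.map_apply, hι.comap_apply, Measure.smul_apply, hι.comap_apply, smul_eq_mul]
    have himg : ι '' (T ⁻¹' s) = L ⁻¹' (ι '' s) := by
      have hinj : Function.Injective L :=
        (LinearMap.equivOfDetNeZero L hL).injective
      ext x
      constructor
      · rintro ⟨y, hy, rfl⟩
        exact ⟨T y, hy, hT y⟩
      · rintro ⟨y, hy, hyx⟩
        refine ⟨T.symm y, by simpa using hy, hinj ?_⟩
        rw [← hT, T.apply_symm_apply, hyx]
    rw [himg, Measure.addHaar_preimage_linearMap μ hL, hc, abs_inv,
      ENNReal.ofReal_inv_of_pos (abs_pos.2 hL)]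
  refine ⟨T.measurable, ?_⟩
  ext s hs
  rw [T.map_apply, withDensity_apply _ (T.measurable hs), withDensity_apply _ hs]
  calc ∫⁻ x in T ⁻¹' s, w x ∂μ.comap ι
      = ∫⁻ x in T ⁻¹' s, c * w (T x) ∂μ.comap ι := by
        refine lintegral_congr fun x => ?_
        rw [← hw x, mul_comm]
    _ = c * ∫⁻ x in T ⁻¹' s, w (T x) ∂μ.comap ι := lintegral_const_mul' _ _ hct
    _ = c * ∫⁻ x in s, w x ∂(μ.comap ι).map T := by
        rw [← lintegral_map_equiv w T, ← T.restrict_map]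
    _ = ∫⁻ x in s, w x ∂μ.comap ι := by
        rw [hmap, Measure.restrict_smul, lintegral_smul_measure, smul_eq_mul, ← mul_assoc,
          ENNReal.mul_inv_cancel hc0 hct, one_mul]

/-- The determinant of a diagonal endomorphism of a space of functions. -/
theorem det_linearMap_of_diagonal {ι : Type*} [Fintype ι] [DecidableEq ι]
    (L : (ι → ℝ) →ₗ[ℝ] (ι → ℝ)) (c : ι → ℝ) (h : ∀ x i, L x i = c i * x i) :
    LinearMap.det L = ∏ i, c i := by
  have : L = Matrix.toLin' (diagonal c) := by
    ext x i
    simp [h, mulVec_diagonal]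
  rw [this, LinearMap.det_toLin', det_diagonal]

/-! ### Haar measure on $GL(n)$ and $GL^+(n)$. -/

section GeneralLinear

variable {n : ℕ}

open scoped Matrix.Norms.Frobenius in
theorem isOpenEmbedding_glVal :
    Topology.IsOpenEmbedding (fun A : GL (Fin n) ℝ => (A : Matrix (Fin n) (Fin n) ℝ)) :=
  Units.isOpenEmbedding_val

instance glBorelSpace : BorelSpace (GL (Fin n) ℝ) := by
  refine ⟨?_⟩
  rw [isOpenEmbedding_glVal.isInducing.eq_induced, borel_comap, ← BorelSpace.measurable_eq]
  rfl

instance glSecondCountable : SecondCountableTopology (GL (Fin n) ℝ) :=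
  haveI : SecondCountableTopology (Matrix (Fin n) (Fin n) ℝ) :=
    inferInstanceAs (SecondCountableTopology (Fin n → Fin n → ℝ))
  isOpenEmbedding_glVal.isInducing.secondCountableTopology

instance glLocallyCompact : LocallyCompactSpace (GL (Fin n) ℝ) :=
  haveI : LocallyCompactSpace (Matrix (Fin n) (Fin n) ℝ) :=
    inferInstanceAs (LocallyCompactSpace (Fin n → Fin n → ℝ))
  isOpenEmbedding_glVal.locallyCompactSpace

theorem isOpenEmbedding_glEntries : Topology.IsOpenEmbedding
    (fun (A : GL (Fin n) ℝ) (i j : Fin n) => (A : Matrix (Fin n) (Fin n) ℝ) i j) :=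
  isOpenEmbedding_glVal

/-- Left multiplication by a matrix, as a multiplicative family of endomorphisms of
`ℝ^(n × n)`. -/
def mulLeftEnd (n : ℕ) : Matrix (Fin n) (Fin n) ℝ →* Module.End ℝ (Fin n → Fin n → ℝ) where
  toFun A :=
    { toFun := fun X => (A * Matrix.of X : Matrix _ _ ℝ)
      map_add' := fun X Y => Matrix.mul_add A (Matrix.of X) (Matrix.of Y)
      map_smul' := fun c X => Matrix.mul_smul A c (Matrix.of X) }
  map_one' := by
    refine LinearMap.ext fun X => ?_
    exact Matrix.one_mul (Matrix.of X)
  map_mul' A B := by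
    refine LinearMap.ext fun X => ?_
    exact Matrix.mul_assoc A B (Matrix.of X)

/-- Both sides are multiplicative in $A$, so diagonal $A$ suffices. There entry $(i,j)$ is scaled by
$D_i$, and each $D_i$ occurs $n$ times. -/
theorem det_mulLeftEnd (A : Matrix (Fin n) (Fin n) ℝ) (hA : A.det ≠ 0) :
    LinearMap.det (mulLeftEnd n A) = A.det ^ n := by
  refine monoidHom_eq_of_diagonal ((LinearMap.det).comp (mulLeftEnd n))
    ((powMonoidHom n).comp detMonoidHom) (fun D => ?_) A hA
  change LinearMap.det (mulLeftEnd n (diagonal D)) = (diagonal D).det ^ n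
  rw [← LinearMap.det_conj (mulLeftEnd n (diagonal D))
    (LinearEquiv.curry ℝ ℝ (Fin n) (Fin n)).symm,
    det_linearMap_of_diagonal _ (fun p => D p.1), Fintype.prod_prod_type, det_diagonal]
  · simp [Finset.prod_pow]
  · rintro x ⟨i, j⟩
    exact diagonal_mul D (Matrix.of (Function.curry x)) i j

theorem glHaar_mul_left (A : GL (Fin n) ℝ) :
    MeasurePreserving (fun B => A * B) (glHaar n) (glHaar n) := by
  have hA : (A : Matrix (Fin n) (Fin n) ℝ).det ≠ 0 :=
    (Matrix.isUnit_iff_isUnit_det _).1 A.isUnit |>.ne_zero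
  refine measurePreserving_withDensity_comap volume
    isOpenEmbedding_glEntries.measurableEmbedding
    (Homeomorph.mulLeft A).toMeasurableEquiv (mulLeftEnd n A.1) ?_ (fun B => rfl) (fun B => ?_)
  · rw [det_mulLeftEnd _ hA]
    exact pow_ne_zero _ hA
  · have hB : (B : Matrix (Fin n) (Fin n) ℝ).det ≠ 0 :=
      (Matrix.isUnit_iff_isUnit_det _).1 B.isUnit |>.ne_zero
    change ENNReal.ofReal (|(A.1 * B.1).det| ^ n)⁻¹ * _ = _
    rw [det_mulLeftEnd _ hA, ← ENNReal.ofReal_mul (by positivity), det_mul, abs_mul, abs_pow]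
    congr 1
    have : 0 < |A.1.det| := abs_pos.2 hA
    have : 0 < |B.1.det| := abs_pos.2 hB
    rw [mul_pow]
    field_simp

theorem continuous_glDensity : Continuous
    fun A : GL (Fin n) ℝ => (|(A : Matrix (Fin n) (Fin n) ℝ).det| ^ n)⁻¹ := by
  refine Continuous.inv₀ ?_ fun A => ?_
  · exact (isOpenEmbedding_glVal.continuous.matrix_det.abs).pow n
  · exact pow_ne_zero _ (abs_ne_zero.2
      ((Matrix.isUnit_iff_isUnit_det _).1 A.isUnit |>.ne_zero))

theorem isHaarMeasure_glHaar : (glHaar n).IsHaarMeasure := by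
  have h1 : (glHaar n).IsMulLeftInvariant := ⟨fun A => (glHaar_mul_left A).map_eq⟩
  have h2 : IsLocallyFiniteMeasure (glHaar n) := by
    have : IsLocallyFiniteMeasure (Measure.comap
        (fun (A : GL (Fin n) ℝ) (i j : Fin n) => (A : Matrix (Fin n) (Fin n) ℝ) i j) volume) :=
      haveI := IsFiniteMeasureOnCompacts.comap' (volume : Measure (Fin n → Fin n → ℝ))
        (isOpenEmbedding_glEntries (n := n)).continuous
        isOpenEmbedding_glEntries.measurableEmbedding
      isLocallyFiniteMeasure_of_isFiniteMeasureOnCompacts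
    exact IsLocallyFiniteMeasure.withDensity_ofReal continuous_glDensity
  have h3 : (glHaar n).IsOpenPosMeasure := by
    have : (Measure.comap (fun (A : GL (Fin n) ℝ) (i j : Fin n) =>
        (A : Matrix (Fin n) (Fin n) ℝ) i j) volume).IsOpenPosMeasure :=
      Measure.IsOpenPosMeasure.comap _ isOpenEmbedding_glEntries
    refine Measure.AbsolutelyContinuous.isOpenPosMeasure
      (withDensity_absolutelyContinuous' ?_ ?_)
    · exact continuous_glDensity.measurable.ennreal_ofReal.aemeasurable
    · refine .of_forall fun A => ?_
      have : 0 < |(A : Matrix (Fin n) (Fin n) ℝ).det| :=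
        abs_pos.2 ((Matrix.isUnit_iff_isUnit_det _).1 A.isUnit |>.ne_zero)
      simp only [ne_eq, ENNReal.ofReal_eq_zero, not_le]
      positivity
  exact { toIsMulLeftInvariant := h1, toIsOpenPosMeasure := h3,
          lt_top_of_isCompact := fun _ hK => hK.measure_lt_top }

theorem isOpenEmbedding_glPosVal :
    Topology.IsOpenEmbedding (Subtype.val : Matrix.GLPos (Fin n) ℝ → GL (Fin n) ℝ) := by
  refine IsOpen.isOpenEmbedding_subtypeVal ?_
  have : {A : GL (Fin n) ℝ | A ∈ Matrix.GLPos (Fin n) ℝ}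
      = (fun A : GL (Fin n) ℝ => (A : Matrix (Fin n) (Fin n) ℝ).det) ⁻¹' Set.Ioi 0 := by
    ext A
    rfl
  change IsOpen {A : GL (Fin n) ℝ | A ∈ Matrix.GLPos (Fin n) ℝ}
  exact this ▸ isOpen_Ioi.preimage isOpenEmbedding_glVal.continuous.matrix_det

theorem isHaarMeasure_glPosHaar : (glPosHaar n).IsHaarMeasure :=
  haveI := isHaarMeasure_glHaar (n := n)
  Measure.IsHaarMeasure.comap (mH := inferInstance) (glHaar n)
    (f := (Matrix.GLPos (Fin n) ℝ).subtype)
    isOpenEmbedding_glPosVal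

end GeneralLinear

/-! ### The invariant measure on $SPD(n)$. -/

section PositiveDefinite

variable {n : ℕ}

/-- The symmetric matrix with given entries on and above the diagonal. -/
def symOfUpper (n : ℕ) :
    ({p : Fin n × Fin n // p.1 ≤ p.2} → ℝ) →ₗ[ℝ] Matrix (Fin n) (Fin n) ℝ where
  toFun y := Matrix.of fun i j => y ⟨(min i j, max i j), min_le_max⟩
  map_add' _ _ := rfl
  map_smul' _ _ := rfl

/-- The entries of a matrix on and above the diagonal. -/
def upperEntries (n : ℕ) :
    Matrix (Fin n) (Fin n) ℝ →ₗ[ℝ] ({p : Fin n × Fin n // p.1 ≤ p.2} → ℝ) where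
  toFun X p := X p.1.1 p.1.2
  map_add' _ _ := rfl
  map_smul' _ _ := rfl

theorem symOfUpper_apply (y : {p : Fin n × Fin n // p.1 ≤ p.2} → ℝ) (i j : Fin n) :
    symOfUpper n y i j = y ⟨(min i j, max i j), min_le_max⟩ := rfl

theorem upperEntries_apply (X : Matrix (Fin n) (Fin n) ℝ)
    (p : {p : Fin n × Fin n // p.1 ≤ p.2}) : upperEntries n X p = X p.1.1 p.1.2 := rfl

theorem transpose_symOfUpper (y : {p : Fin n × Fin n // p.1 ≤ p.2} → ℝ) :
    (symOfUpper n y)ᵀ = symOfUpper n y := by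
  ext i j
  simp only [transpose_apply, symOfUpper_apply, min_comm, max_comm]

theorem symOfUpper_upperEntries {X : Matrix (Fin n) (Fin n) ℝ} (hX : Xᵀ = X) :
    symOfUpper n (upperEntries n X) = X := by
  ext i j
  rw [symOfUpper_apply, upperEntries_apply]
  rcases le_total i j with h | h
  · simp [h]
  · simp only [h, min_eq_right, max_eq_left]
    exact congrFun (congrFun hX i) j

theorem upperEntries_symOfUpper (y : {p : Fin n × Fin n // p.1 ≤ p.2} → ℝ) :
    upperEntries n (symOfUpper n y) = y := by
  ext ⟨⟨i, j⟩, h⟩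
  have h' : i ≤ j := h
  simp [symOfUpper_apply, upperEntries_apply, h']

theorem SPD.transpose_eq (S : SPD n) : S.1ᵀ = S.1 :=
  (conjTranspose_eq_transpose_of_trivial S.1).symm.trans S.2.1

/-- The action `S ↦ A S Aᵀ` in the coordinates `S i j`, `i ≤ j`. -/
def congrEnd (n : ℕ) :
    Matrix (Fin n) (Fin n) ℝ →* Module.End ℝ ({p : Fin n × Fin n // p.1 ≤ p.2} → ℝ) where
  toFun A := upperEntries n ∘ₗ LinearMap.mulRight ℝ Aᵀ ∘ₗ LinearMap.mulLeft ℝ A ∘ₗ symOfUpper n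
  map_one' := by
    refine LinearMap.ext fun y => ?_
    simp [upperEntries_symOfUpper]
  map_mul' A B := by
    refine LinearMap.ext fun y => ?_
    have h : (B * symOfUpper n y * Bᵀ)ᵀ = B * symOfUpper n y * Bᵀ := by
      simp [transpose_mul, transpose_symOfUpper, Matrix.mul_assoc]
    simp only [LinearMap.comp_apply, LinearMap.mulLeft_apply, LinearMap.mulRight_apply,
      Module.End.mul_apply, symOfUpper_upperEntries h]
    simp only [transpose_mul, Matrix.mul_assoc]

theorem congrEnd_apply (A : Matrix (Fin n) (Fin n) ℝ)
    (y : {p : Fin n × Fin n // p.1 ≤ p.2} → ℝ) :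
    congrEnd n A y = upperEntries n (A * symOfUpper n y * Aᵀ) := rfl

/-- Splitting off the second factor and swapping indices, $d_i$ is counted once for each $j\ge i$
and once for each $j\le i$: $n+1$ times, since $j=i$ counts twice. -/
theorem prod_upper_mul (d : Fin n → ℝ) :
    ∏ p : {p : Fin n × Fin n // p.1 ≤ p.2}, d p.1.1 * d p.1.2 = (∏ i, d i) ^ (n + 1) := by
  have h1 : ∏ p : {p : Fin n × Fin n // p.1 ≤ p.2}, d p.1.1 * d p.1.2
      = ∏ i, ∏ j, if i ≤ j then d i * d j else 1 := by
    rw [← Fintype.prod_prod_type' (f := fun i j => if i ≤ j then d i * d j else 1),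
      ← Finset.prod_filter, ← Finset.prod_subtype (p := fun p : Fin n × Fin n => p.1 ≤ p.2)
        (Finset.univ.filter fun p : Fin n × Fin n => p.1 ≤ p.2) (by simp)
        (fun p => d p.1 * d p.2)]
  have h2 : ∏ i, ∏ j, (if i ≤ j then d i * d j else 1)
      = (∏ i, ∏ j, if i ≤ j then d i else 1) * ∏ i, ∏ j, if j ≤ i then d i else 1 := by
    rw [Finset.prod_comm (f := fun i j => if j ≤ i then d i else 1), ← Finset.prod_mul_distrib]
    refine Finset.prod_congr rfl fun i _ => ?_
    rw [← Finset.prod_mul_distrib]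
    refine Finset.prod_congr rfl fun j _ => ?_
    split_ifs <;> simp
  rw [h1, h2, ← Finset.prod_mul_distrib, ← Finset.prod_pow]
  refine Finset.prod_congr rfl fun i _ => ?_
  rw [← Finset.prod_mul_distrib]
  have h3 : ∀ j, ((if i ≤ j then d i else 1) * if j ≤ i then d i else 1)
      = d i * if i = j then d i else 1 := by
    intro j
    rcases lt_trichotomy i j with h | h | h
    · simp [h.le, h.ne, h.not_ge]
    · simp [h]
    · simp [h.le, h.ne', h.not_ge]
  simp only [h3, Finset.prod_mul_distrib, Finset.prod_ite_eq, Finset.mem_univ, if_true,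
    Finset.prod_const, Finset.card_univ, Fintype.card_fin, pow_succ]

theorem det_congrEnd (A : Matrix (Fin n) (Fin n) ℝ) (hA : A.det ≠ 0) :
    LinearMap.det (congrEnd n A) = A.det ^ (n + 1) := by
  refine monoidHom_eq_of_diagonal ((LinearMap.det).comp (congrEnd n))
    ((powMonoidHom (n + 1)).comp detMonoidHom) (fun D => ?_) A hA
  change LinearMap.det (congrEnd n (diagonal D)) = (diagonal D).det ^ (n + 1)
  rw [det_linearMap_of_diagonal _ (fun p => D p.1.1 * D p.1.2), det_diagonal, prod_upper_mul]
  rintro x ⟨⟨i, j⟩, h⟩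
  have h' : i ≤ j := h
  rw [congrEnd_apply, upperEntries_apply, diagonal_transpose, mul_diagonal, diagonal_mul,
    symOfUpper_apply]
  simp only [h', min_eq_left, max_eq_right]
  ring

theorem continuous_spdEntries : Continuous
    (fun (S : SPD n) (p : {p : Fin n × Fin n // p.1 ≤ p.2}) => S.1 p.1.1 p.1.2) := by
  refine continuous_pi fun p => ?_
  exact continuous_subtype_val.matrix_elem _ _

/-- Semidefiniteness is a closed condition and $\det\ne0$ an open one. Being Borel makes $SPD(n)$ a
standard Borel space, so injective Borel maps out of it are measurable embeddings. -/
theorem measurableSet_posDef :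
    MeasurableSet {S : Matrix (Fin n) (Fin n) ℝ | S.PosDef} := by
  have h : {S : Matrix (Fin n) (Fin n) ℝ | S.PosDef} =
      ({S | Sᵀ = S} ∩ ⋂ x : Fin n → ℝ, {S | 0 ≤ x ⬝ᵥ (S *ᵥ x)}) ∩ {S | S.det ≠ 0} := by
    ext S
    simp only [Set.mem_inter_iff, Set.mem_ofPred_eq, Set.mem_iInter]
    constructor
    · intro hS
      have := posSemidef_iff_dotProduct_mulVec.1 hS.posSemidef
      exact ⟨⟨SPD.transpose_eq ⟨S, hS⟩, fun x => by simpa using this.2 x⟩, hS.det_pos.ne'⟩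
    · rintro ⟨⟨h1, h2⟩, h3⟩
      have : S.PosSemidef := posSemidef_iff_dotProduct_mulVec.2
        ⟨(conjTranspose_eq_transpose_of_trivial S).trans h1, fun x => by simpa using h2 x⟩
      exact this.posDef_iff_det_ne_zero.2 h3
  rw [h]
  refine MeasurableSet.inter (IsClosed.inter ?_ (isClosed_iInter fun x => ?_)).measurableSet
    (IsOpen.measurableSet ?_)
  · exact isClosed_eq continuous_id.matrix_transpose continuous_id
  · exact isClosed_le continuous_const
      (continuous_const.dotProduct (continuous_id.matrix_mulVec continuous_const))
  · exact isOpen_ne_fun continuous_id.matrix_det continuous_const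

instance matrixPolishSpace : PolishSpace (Matrix (Fin n) (Fin n) ℝ) :=
  inferInstanceAs (PolishSpace (Fin n → Fin n → ℝ))

instance spdStandardBorel : StandardBorelSpace (SPD n) :=
  MeasurableSet.standardBorel measurableSet_posDef

theorem measurableEmbedding_spdEntries : MeasurableEmbedding
    (fun (S : SPD n) (p : {p : Fin n × Fin n // p.1 ≤ p.2}) => S.1 p.1.1 p.1.2) := by
  refine continuous_spdEntries.measurable.measurableEmbedding fun S T h => Subtype.ext ?_
  rw [← symOfUpper_upperEntries S.transpose_eq, ← symOfUpper_upperEntries T.transpose_eq]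
  exact congrArg (symOfUpper n) h

theorem isFiniteMeasureOnCompacts_spdMeasure : IsFiniteMeasureOnCompacts (spdMeasure n) := by
  have := IsFiniteMeasureOnCompacts.comap'
    (volume : Measure ({p : Fin n × Fin n // p.1 ≤ p.2} → ℝ))
    (continuous_spdEntries (n := n)) measurableEmbedding_spdEntries
  refine ⟨fun K hK => ?_⟩
  have hc : ContinuousOn (fun S : SPD n => |S.1.det| ^ (-((n : ℝ) + 1) / 2)) K := by
    refine Continuous.continuousOn (Continuous.rpow_const ?_ fun S => Or.inl ?_)
    · exact continuous_subtype_val.matrix_det.abs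
    · exact abs_ne_zero.2 S.2.det_pos.ne'
  obtain ⟨C, hC⟩ := (hK.image_of_continuousOn hc).bddAbove
  rw [spdMeasure, withDensity_apply _ hK.measurableSet]
  calc _ ≤ ∫⁻ _ in K, ENNReal.ofReal C ∂(Measure.comap (fun (S : SPD n)
          (p : {p : Fin n × Fin n // p.1 ≤ p.2}) => S.1 p.1.1 p.1.2) volume) := by
        refine setLIntegral_mono' hK.measurableSet fun S hS => ?_
        exact ENNReal.ofReal_le_ofReal (hC ⟨S, hS, rfl⟩)
    _ < ∞ := by
        rw [setLIntegral_const]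
        exact ENNReal.mul_lt_top ENNReal.ofReal_lt_top hK.measure_lt_top

theorem det_gl_ne_zero (A : GL (Fin n) ℝ) : (A : Matrix (Fin n) (Fin n) ℝ).det ≠ 0 :=
  (Matrix.isUnit_iff_isUnit_det _).1 A.isUnit |>.ne_zero

theorem spdAct_mul (A B : GL (Fin n) ℝ) (S : SPD n) :
    spdAct A (spdAct B S) = spdAct (A * B) S :=
  Subtype.ext (by simp [spdAct, transpose_mul, Matrix.mul_assoc])

theorem spdAct_one (S : SPD n) : spdAct 1 S = S := Subtype.ext (by simp [spdAct])

theorem continuous_spdAct (A : GL (Fin n) ℝ) : Continuous (spdAct A) := by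
  refine Continuous.subtype_mk ?_ _
  fun_prop

/-- The action of an invertible matrix on `SPD(n)`, as a measurable equivalence. -/
def spdActEquiv (A : GL (Fin n) ℝ) : SPD n ≃ᵐ SPD n where
  toFun := spdAct A
  invFun := spdAct A⁻¹
  left_inv S := by rw [spdAct_mul, inv_mul_cancel, spdAct_one]
  right_inv S := by rw [spdAct_mul, mul_inv_cancel, spdAct_one]
  measurable_toFun := (continuous_spdAct A).measurable
  measurable_invFun := (continuous_spdAct A⁻¹).measurable

/-- The density contributes $|\det A|^{2\cdot(-(n+1)/2)}$, which cancels the Jacobian $|\det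
A|^{n+1}$. -/
theorem measurePreserving_spdAct (A : GL (Fin n) ℝ) :
    MeasurePreserving (spdAct A) (spdMeasure n) (spdMeasure n) := by
  have hA := det_gl_ne_zero A
  refine measurePreserving_withDensity_comap volume measurableEmbedding_spdEntries
    (spdActEquiv A) (congrEnd n A.1) ?_ (fun S => ?_) (fun S => ?_)
  · rw [det_congrEnd _ hA]
    exact pow_ne_zero _ hA
  · change upperEntries n (A.1 * S.1 * A.1ᵀ) = congrEnd n A.1 (upperEntries n S.1)
    rw [congrEnd_apply, symOfUpper_upperEntries S.transpose_eq]
  · change ENNReal.ofReal (|(A.1 * S.1 * A.1ᵀ).det| ^ (-((n : ℝ) + 1) / 2)) * _ = _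
    rw [det_congrEnd _ hA, ← ENNReal.ofReal_mul (by positivity), det_mul, det_mul, det_transpose]
    congr 1
    have h1 : 0 < |A.1.det| := abs_pos.2 hA
    have h2 : |A.1.det * S.1.det * A.1.det| = |A.1.det| ^ (2 : ℝ) * |S.1.det| := by
      rw [abs_mul, abs_mul, Real.rpow_two]; ring
    rw [h2, Real.mul_rpow (by positivity) (by positivity), ← Real.rpow_mul h1.le, abs_pow,
      ← Real.rpow_natCast, mul_right_comm, ← Real.rpow_add h1]
    push_cast
    rw [show 2 * ((-((n : ℝ) + 1)) / 2) + (n + 1) = 0 by ring, Real.rpow_zero, one_mul]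

end PositiveDefinite

/-! ### Polar decomposition and proportionality of the two measures. -/

section Polar

variable {n : ℕ}

/-- The positive square root of a positive definite matrix. -/
noncomputable def SPD.sqrt (S : SPD n) : SPD n :=
  ⟨CFC.sqrt S.1, (CFC.sqrt_nonneg S.1).posSemidef.posDef_iff_det_ne_zero.2 (det_sqrt_pos S).ne'⟩

theorem SPD.sqrt_mul_sqrt (S : SPD n) : S.sqrt.1 * S.sqrt.1 = S.1 :=
  CFC.sqrt_mul_sqrt_self S.1 S.2.posSemidef.nonneg

/-- The square of a positive definite matrix. -/
def SPD.sq (S : SPD n) : SPD n :=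
  ⟨S.1 * S.1, by
    have h := (spdAct (GeneralLinearGroup.mkOfDetNeZero S.1 S.2.det_pos.ne')
      ⟨1, PosDef.one⟩).2
    simpa [spdAct, S.transpose_eq, GeneralLinearGroup.mkOfDetNeZero] using h⟩

theorem SPD.sqrt_sq (S : SPD n) : S.sq.sqrt = S :=
  Subtype.ext (CFC.sqrt_mul_self S.1 S.2.posSemidef.nonneg)

theorem SPD.sq_sqrt (S : SPD n) : S.sqrt.sq = S := Subtype.ext S.sqrt_mul_sqrt

/-- The square root inverts the continuous injection `SPD.sq` of a standard Borel space, so its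
preimages are images under a measurable embedding. -/
theorem SPD.measurable_sqrt : Measurable (SPD.sqrt (n := n)) := by
  have hsq : Measurable (SPD.sq (n := n)) := by
    refine Continuous.measurable (Continuous.subtype_mk ?_ _)
    exact continuous_subtype_val.mul continuous_subtype_val
  have hemb : MeasurableEmbedding (SPD.sq (n := n)) :=
    hsq.measurableEmbedding fun S T h => by rw [← S.sqrt_sq, h, T.sqrt_sq]
  refine fun s hs => ?_
  have : SPD.sqrt ⁻¹' s = SPD.sq '' s := by
    ext S
    constructor
    · exact fun h => ⟨S.sqrt, h, S.sq_sqrt⟩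
    · rintro ⟨T, hT, rfl⟩
      simpa [SPD.sqrt_sq] using hT
  rw [this]
  exact hemb.measurableSet_image.2 hs

theorem polarMap_val (S : SPD n) (R : OGroup n) :
    (polarMap n (S, R) : Matrix (Fin n) (Fin n) ℝ) = S.sqrt.1 * R.1 := rfl

theorem OGroup.mul_transpose (R : OGroup n) : R.1 * R.1ᵀ = 1 :=
  (Matrix.mem_orthogonalGroup_iff (Fin n) ℝ).1 R.2

/-- The positive definite matrix `A Aᵀ`. -/
def gramSPD (A : GL (Fin n) ℝ) : SPD n := spdAct A ⟨1, PosDef.one⟩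

theorem gramSPD_val (A : GL (Fin n) ℝ) : (gramSPD A).1 = A.1 * A.1ᵀ := by
  simp [gramSPD, spdAct]

theorem gramSPD_polarMap (S : SPD n) (R : OGroup n) : gramSPD (polarMap n (S, R)) = S := by
  refine Subtype.ext ?_
  rw [gramSPD_val, polarMap_val, transpose_mul, S.sqrt.transpose_eq, Matrix.mul_assoc,
    ← Matrix.mul_assoc R.1, R.mul_transpose, Matrix.one_mul, S.sqrt_mul_sqrt]

theorem gramSPD_mul (A B : GL (Fin n) ℝ) : gramSPD (A * B) = spdAct A (gramSPD B) := by
  rw [gramSPD, gramSPD, spdAct_mul]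

/-- The orthogonal factor of the polar decomposition. -/
noncomputable def polarAngle (A : GL (Fin n) ℝ) : OGroup n :=
  ⟨(gramSPD A).sqrt.1⁻¹ * A.1, by
    rw [Matrix.mem_orthogonalGroup_iff, transpose_mul, transpose_nonsing_inv,
      SPD.transpose_eq, Matrix.mul_assoc, ← Matrix.mul_assoc A.1, ← gramSPD_val,
      ← (gramSPD A).sqrt_mul_sqrt]
    have h : IsUnit (gramSPD A).sqrt.1.det := (gramSPD A).sqrt.2.det_pos.ne'.isUnit
    rw [Matrix.mul_assoc, Matrix.mul_nonsing_inv _ h, Matrix.mul_one,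
      Matrix.nonsing_inv_mul _ h]⟩

theorem polarMap_gramSPD_polarAngle (A : GL (Fin n) ℝ) :
    polarMap n (gramSPD A, polarAngle A) = A := by
  refine Units.ext ?_
  rw [polarMap_val]
  exact Matrix.mul_nonsing_inv_cancel_left _ _ (gramSPD A).sqrt.2.det_pos.ne'.isUnit

theorem polarMap_mul (S : SPD n) (Q R : OGroup n) :
    (polarMap n (S, Q * R) : Matrix (Fin n) (Fin n) ℝ) = polarMap n (S, Q) * R.1 := by
  rw [polarMap_val, polarMap_val, Matrix.mul_assoc]
  rfl

theorem bijective_polarMap : Function.Bijective (polarMap n) := by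
  constructor
  · rintro ⟨S, R⟩ ⟨T, Q⟩ h
    have h1 : S = T := by rw [← gramSPD_polarMap S R, h, gramSPD_polarMap]
    subst h1
    have h2 : S.sqrt.1 * R.1 = S.sqrt.1 * Q.1 := congrArg Units.val h
    have h3 : R.1 = Q.1 := by
      rw [← Matrix.nonsing_inv_mul_cancel_left _ R.1 S.sqrt.2.det_pos.ne'.isUnit, h2,
        Matrix.nonsing_inv_mul_cancel_left _ Q.1 S.sqrt.2.det_pos.ne'.isUnit]
    rw [Subtype.ext h3]
  · exact fun A => ⟨_, polarMap_gramSPD_polarAngle A⟩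

/-- $AS^{1/2}$ has Gram matrix $ASA^T$, so $AS^{1/2}=(ASA^T)^{1/2}k$ with $k$ orthogonal.
Multiplying by $R$ on the right changes only the orthogonal factor, and does so by left translation
by $k$. -/
theorem glMul_polarMap (A : GL (Fin n) ℝ) (S : SPD n) (R : OGroup n) :
    A * polarMap n (S, R) = polarMap n (spdAct A S, polarAngle (A * polarMap n (S, 1)) * R) := by
  have h : gramSPD (A * polarMap n (S, 1)) = spdAct A S := by
    rw [gramSPD_mul, gramSPD_polarMap]
  have h1 := polarMap_gramSPD_polarAngle (A * polarMap n (S, 1))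
  rw [h] at h1
  refine Units.ext ?_
  rw [polarMap_mul, h1]
  have h2 := polarMap_mul S 1 R
  rw [one_mul] at h2
  rw [Units.val_mul, Units.val_mul, h2, Matrix.mul_assoc]

theorem measurable_glVal :
    Measurable (fun A : GL (Fin n) ℝ => (A : Matrix (Fin n) (Fin n) ℝ)) :=
  isOpenEmbedding_glVal.continuous.measurable

theorem measurable_polarMap : Measurable (polarMap n) := by
  refine isOpenEmbedding_glVal.measurableEmbedding.measurable_comp_iff.1 ?_
  have h1 : Measurable fun p : SPD n × OGroup n => (SPD.sqrt p.1).1 :=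
    measurable_subtype_coe.comp (SPD.measurable_sqrt.comp measurable_fst)
  have h2 : Measurable fun p : SPD n × OGroup n => p.2.1 :=
    measurable_subtype_coe.comp measurable_snd
  have hm : Continuous fun q : Matrix (Fin n) (Fin n) ℝ × Matrix (Fin n) (Fin n) ℝ =>
    q.1 * q.2 := continuous_fst.matrix_mul continuous_snd
  have : BorelSpace (Matrix (Fin n) (Fin n) ℝ × Matrix (Fin n) (Fin n) ℝ) := Prod.borelSpace
  exact hm.measurable.comp (h1.prodMk h2)

theorem continuous_gramSPD : Continuous (gramSPD (n := n)) := by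
  refine Continuous.subtype_mk ?_ _
  have := isOpenEmbedding_glVal (n := n).continuous
  fun_prop

instance matrixSecondCountable : SecondCountableTopology (Matrix (Fin n) (Fin n) ℝ) :=
  inferInstanceAs (SecondCountableTopology (Fin n → Fin n → ℝ))

/-- With the angle written as a quotient in the group $GL(n)$, its measurability follows from that
of the group operations. -/
theorem polarAngle_val (A : GL (Fin n) ℝ) :
    (polarAngle A).1 = ((polarMap n (gramSPD A, 1))⁻¹ * A : GL (Fin n) ℝ).1 := by
  have h := polarMap_mul (gramSPD A) 1 (polarAngle A)
  rw [one_mul, polarMap_gramSPD_polarAngle] at h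
  rw [Units.val_mul, h, ← Matrix.mul_assoc, ← Units.val_mul, inv_mul_cancel, Units.val_one,
    Matrix.one_mul]

theorem measurable_polarAngle : Measurable (polarAngle (n := n)) := by
  refine Measurable.subtype_mk (f := fun A : GL (Fin n) ℝ => (polarAngle A).1) ?_
  simp only [polarAngle_val]
  refine measurable_glVal.comp (Measurable.mul (Measurable.inv ?_) measurable_id)
  exact measurable_polarMap.comp (continuous_gramSPD.measurable.prodMk measurable_const)

instance compactSpace_orthogonalGroup : CompactSpace (OGroup n) := by
  have hK : IsCompact (Set.pi Set.univ fun _ : Fin n => Set.pi Set.univ fun _ : Fin n =>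
      Set.Icc (-1 : ℝ) 1) :=
    isCompact_univ_pi fun _ => isCompact_univ_pi fun _ => isCompact_Icc
  refine isCompact_iff_compactSpace.1 (IsCompact.of_isClosed_subset
    (t := (Matrix.orthogonalGroup (Fin n) ℝ : Set (Matrix (Fin n) (Fin n) ℝ))) hK ?_ ?_)
  · have : (Matrix.orthogonalGroup (Fin n) ℝ : Set (Matrix (Fin n) (Fin n) ℝ))
        = {R | R * Rᵀ = 1} := by
      ext R
      exact Matrix.mem_orthogonalGroup_iff (Fin n) ℝ
    rw [this]
    exact isClosed_eq (continuous_id.matrix_mul continuous_id.matrix_transpose) continuous_const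
  · intro R hR i _ j _
    exact abs_le.1 (entry_norm_bound_of_unitary hR i j)

instance orthogonalSecondCountable : SecondCountableTopology (OGroup n) :=
  TopologicalSpace.Subtype.secondCountableTopology _

instance orthogonalMeasurableMul : MeasurableMul₂ (OGroup n) :=
  ContinuousMul.measurableMul₂

instance sFinite_spdMeasure : SFinite (spdMeasure n) := by
  have : SigmaFinite (Measure.comap (fun (S : SPD n) (p : {p : Fin n × Fin n // p.1 ≤ p.2}) =>
      S.1 p.1.1 p.1.2) volume) := by
    refine SigmaFinite.of_map _ measurableEmbedding_spdEntries.measurable.aemeasurable ?_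
    rw [measurableEmbedding_spdEntries.map_comap]
    infer_instance
  rw [spdMeasure]
  infer_instance

/-- A skew product preserves the product measure when the base map and almost every fibre map do;
the fibre maps here are left translations of $O(n)$. -/
theorem measurePreserving_orthogonal_mul (A : GL (Fin n) ℝ) (μO : Measure (OGroup n))
    [μO.IsMulLeftInvariant] [IsFiniteMeasure μO] :
    MeasurePreserving (fun p : SPD n × OGroup n =>
      (spdAct A p.1, polarAngle (A * polarMap n (p.1, 1)) * p.2))
      ((spdMeasure n).prod μO) ((spdMeasure n).prod μO) := by
  refine MeasurePreserving.skew_product (g := fun S R => polarAngle (A * polarMap n (S, 1)) * R)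
    (measurePreserving_spdAct A) ?_ ?_
  · have h : Measurable fun p : SPD n × OGroup n => polarAngle (A * polarMap n (p.1, 1)) :=
      measurable_polarAngle.comp (measurable_const_mul A |>.comp
        (measurable_polarMap.comp (measurable_fst.prodMk measurable_const)))
    exact h.mul measurable_snd
  · exact .of_forall fun S => map_mul_left_eq_self _ _

/-- The image of `μ_SPD ⊗ μ_{O(n)}` under the polar map is a multiple of `μ_{GL(n)}`. -/
theorem exists_map_polarMap_eq_smul (μO : Measure (OGroup n))
    [μO.IsMulLeftInvariant] [IsFiniteMeasure μO] :
    ∃ c : NNReal, ((spdMeasure n).prod μO).map (polarMap n) = c • glHaar n := by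
  have := isFiniteMeasureOnCompacts_spdMeasure (n := n)
  have := isHaarMeasure_glHaar (n := n)
  have h1 : (((spdMeasure n).prod μO).map (polarMap n)).IsMulLeftInvariant := by
    refine ⟨fun A => ?_⟩
    conv_rhs => rw [← (measurePreserving_orthogonal_mul A μO).map_eq]
    rw [Measure.map_map (measurable_const_mul A) measurable_polarMap,
      Measure.map_map measurable_polarMap (measurePreserving_orthogonal_mul A μO).measurable]
    congr 1
    ext1 p
    exact glMul_polarMap A p.1 p.2
  have h2 : IsFiniteMeasureOnCompacts (((spdMeasure n).prod μO).map (polarMap n)) := by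
    refine ⟨fun K hK => ?_⟩
    rw [Measure.map_apply measurable_polarMap hK.measurableSet]
    -- Since $S=AA^T$, the preimage of $K$ lies over the compact set of Gram matrices of $K$, and
    -- the fibre $O(n)$ has finite measure.
    refine lt_of_le_of_lt (measure_mono (t := (gramSPD '' K) ×ˢ Set.univ) ?_) ?_
    · rintro ⟨S, R⟩ h
      exact ⟨⟨_, h, gramSPD_polarMap S R⟩, trivial⟩
    · rw [Measure.prod_prod]
      exact ENNReal.mul_lt_top (hK.image continuous_gramSPD).measure_lt_top (measure_lt_top _ _)
  exact ⟨_, Measure.isMulLeftInvariant_eq_smul _ (glHaar n)⟩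

end Polar

/-! ### Distortion of measures on small sets by strictly differentiable maps. -/

section LocalMeasure

open Filter Topology
open scoped NNReal

/-- A strictly differentiable map scales the volume of small sets by nearly `|det L|`. -/
theorem HasStrictFDerivAt.eventually_smallSets_addHaar_image {E : Type*} [NormedAddCommGroup E]
    [NormedSpace ℝ E] [FiniteDimensional ℝ E] [MeasurableSpace E] [BorelSpace E]
    (μ : Measure E) [μ.IsAddHaarMeasure] {f : E → E} {L : E →L[ℝ] E} {a : E}
    (hf : HasStrictFDerivAt f L a) (hL : L.det ≠ 0) {t : ℝ≥0} (ht : 1 < t) :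
    ∀ᶠ s in (𝓝 a).smallSets, ENNReal.ofReal |L.det| * μ s ≤ t * μ (f '' s) ∧
      μ (f '' s) ≤ t * (ENNReal.ofReal |L.det| * μ s) := by
  set d : ℝ≥0 := Real.toNNReal |L.det| with hd
  have hdpos : 0 < d := Real.toNNReal_pos.2 (abs_pos.2 hL)
  have hdet : ENNReal.ofReal |L.det| = d := rfl
  have htpos : 0 < t := one_pos.trans ht
  have h1 : ENNReal.ofReal |L.det| < (t * d : ℝ≥0) := by
    rw [hdet, ENNReal.coe_lt_coe]
    exact lt_mul_of_one_lt_left hdpos ht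
  have h2 : ((t⁻¹ * d : ℝ≥0) : ℝ≥0∞) < ENNReal.ofReal |L.det| := by
    rw [hdet, ENNReal.coe_lt_coe]
    exact mul_lt_of_lt_one_left hdpos (inv_lt_one_of_one_lt₀ ht)
  obtain ⟨δ, ⟨h3, h4⟩, hδ⟩ := ((addHaar_image_le_mul_of_det_lt μ L h1).and
    (mul_le_addHaar_image_of_lt_det μ L h2)).and self_mem_nhdsWithin |>.exists
  obtain ⟨U, hU, hfU⟩ := hf.approximates_deriv_on_nhds (c := δ) (Or.inr hδ)
  refine eventually_smallSets.2 ⟨U, hU, fun s hs => ⟨?_, ?_⟩⟩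
  · have h := h4 s f (hfU.mono_set hs)
    calc ENNReal.ofReal |L.det| * μ s = t * (((t⁻¹ * d : ℝ≥0) : ℝ≥0∞) * μ s) := by
          rw [← mul_assoc, ← ENNReal.coe_mul, mul_inv_cancel_left₀ htpos.ne', hdet]
      _ ≤ t * μ (f '' s) := by gcongr
  · have h := h3 s f (hfU.mono_set hs)
    rwa [ENNReal.coe_mul, mul_assoc] at h

/-- A version of `HasStrictFDerivAt.eventually_smallSets_addHaar_image` for a measure given by a
density in a chart. -/
theorem HasStrictFDerivAt.eventually_smallSets_withDensity_comap_image {E G : Type*}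
    [NormedAddCommGroup E] [NormedSpace ℝ E] [FiniteDimensional ℝ E] [MeasurableSpace E]
    [BorelSpace E] [MeasurableSpace G] (μ : Measure E) [μ.IsAddHaarMeasure] {ι : G → E}
    (hι : MeasurableEmbedding ι) {w : G → ℝ≥0∞} {g : E → G} {L : E →L[ℝ] E} {a : E}
    (hg : HasStrictFDerivAt (fun x => ι (g x)) L a) (hL : L.det ≠ 0)
    (hw : Tendsto (fun x => w (g x)) (𝓝 a) (𝓝 1)) {t : ℝ≥0} (ht : 1 < t) :
    ∀ᶠ s in (𝓝 a).smallSets, MeasurableSet (g '' s) →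
      ENNReal.ofReal |L.det| * μ s ≤ t * (t * ((μ.comap ι).withDensity w (g '' s))) ∧
      (μ.comap ι).withDensity w (g '' s) ≤ t * (t * (ENNReal.ofReal |L.det| * μ s)) := by
  have htpos : 0 < t := one_pos.trans ht
  -- Near $a$ the density lies in $(t^{-1},t)$. This accounts for one of the two factors $t$; the
  -- linear approximation accounts for the other.
  have hw1 : ∀ᶠ x in 𝓝 a, w (g x) < t := hw.eventually_lt_const (by exact_mod_cast ht)
  have hw2 : ∀ᶠ x in 𝓝 a, ((t⁻¹ : ℝ≥0) : ℝ≥0∞) < w (g x) := by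
    refine hw.eventually_const_lt ?_
    exact_mod_cast inv_lt_one_of_one_lt₀ ht
  obtain ⟨U, hU, hwU⟩ := (hw1.and hw2).exists_mem
  filter_upwards [hg.eventually_smallSets_addHaar_image μ hL ht,
    eventually_smallSets.2 ⟨U, hU, fun s hs => hs⟩] with s hs hsU hmeas
  have hcomap : (μ.comap ι) (g '' s) = μ ((fun x => ι (g x)) '' s) := by
    rw [hι.comap_apply, Set.image_image]
  rw [withDensity_apply _ hmeas]
  constructor
  · refine hs.1.trans ?_
    gcongr
    calc μ ((fun x => ι (g x)) '' s)
        = t * ∫⁻ _ in g '' s, ((t⁻¹ : ℝ≥0) : ℝ≥0∞) ∂μ.comap ι := by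
          rw [setLIntegral_const, hcomap, ← mul_assoc, ← ENNReal.coe_mul,
            mul_inv_cancel₀ htpos.ne', ENNReal.coe_one, one_mul]
      _ ≤ _ := by
          refine mul_le_mul' le_rfl (setLIntegral_mono' hmeas ?_)
          rintro _ ⟨x, hx, rfl⟩
          exact (hwU x (hsU hx)).2.le
  · calc _ ≤ ∫⁻ _ in g '' s, (t : ℝ≥0∞) ∂μ.comap ι := by
          refine setLIntegral_mono' hmeas ?_
          rintro _ ⟨x, hx, rfl⟩
          exact (hwU x (hsU hx)).1.le
      _ = t * μ ((fun x => ι (g x)) '' s) := by rw [setLIntegral_const, hcomap]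
      _ ≤ _ := by gcongr; exact hs.2

theorem LipschitzOnWith.euclideanHausdorffMeasure_image_le {X Y : Type*} [MetricSpace X]
    [MetricSpace Y] [MeasurableSpace X] [BorelSpace X] [MeasurableSpace Y] [BorelSpace Y]
    {K : ℝ≥0} {f : X → Y} {s : Set X} (h : LipschitzOnWith K f s) (d : ℕ) :
    μHE[d] (f '' s) ≤ (K : ℝ≥0∞) ^ d * μHE[d] s := by
  simp only [Measure.euclideanHausdorffMeasure_def, Measure.smul_apply, ENNReal.smul_def,
    smul_eq_mul]
  rw [mul_left_comm]
  gcongr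
  simpa using h.hausdorffMeasure_image_le (d := d) (by positivity)

/-- A map whose strict derivative is isometric nearly preserves the Hausdorff measure of small
sets. -/
theorem HasStrictFDerivAt.eventually_smallSets_euclideanHausdorffMeasure_image {E F : Type*}
    [NormedAddCommGroup E] [NormedSpace ℝ E] [MeasurableSpace E] [BorelSpace E]
    [NormedAddCommGroup F] [NormedSpace ℝ F] [MeasurableSpace F] [BorelSpace F]
    {f : E → F} {J : E →L[ℝ] F} {a : E} (hf : HasStrictFDerivAt f J a) (hJ : ∀ x, ‖J x‖ = ‖x‖)
    (d : ℕ) {t : ℝ≥0} (ht : 1 < t) :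
    ∀ᶠ s in (𝓝 a).smallSets, μHE[d] s ≤ t * μHE[d] (f '' s) ∧
      μHE[d] (f '' s) ≤ t * μHE[d] s := by
  obtain ⟨K, hKt, hK⟩ : ∃ K : ℝ≥0, K ^ d < t ∧ 1 < K := by
    have h1 : Tendsto (fun K : ℝ≥0 => K ^ d) (𝓝[>] 1) (𝓝 1) := by
      have : Tendsto (fun K : ℝ≥0 => K ^ d) (𝓝 1) (𝓝 (1 ^ d)) := (continuous_pow d).tendsto 1
      rw [one_pow] at this
      exact this.mono_left nhdsWithin_le_nhds
    exact ((h1.eventually_lt_const ht).and self_mem_nhdsWithin).exists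
  have hKt' : (K : ℝ≥0∞) ^ d ≤ t := by exact_mod_cast hKt.le
  have hKpos : (0 : ℝ) < K := by exact_mod_cast one_pos.trans hK
  have hK1 : (1 : ℝ) < K := by exact_mod_cast hK
  have hδ : 0 < 1 - K⁻¹ := tsub_pos_of_lt (inv_lt_one_of_one_lt₀ hK)
  have hδ' : ((1 - K⁻¹ : ℝ≥0) : ℝ) = 1 - (K : ℝ)⁻¹ := by
    rw [NNReal.coe_sub (inv_le_one_of_one_le₀ hK.le)]; simp
  -- With error at most $(1-K^{-1})\|x-y\|$ and $J$ isometric, distances are multiplied by a factor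
  -- between $K^{-1}$ and $2-K^{-1}\le K$. So $f$ and its inverse are $K$-Lipschitz on $U$, and
  -- $d$-dimensional measure changes by at most $K^d<t$ either way.
  obtain ⟨U, hU, hfU⟩ := hf.approximates_deriv_on_nhds (c := 1 - K⁻¹) (Or.inr hδ)
  have hub : ∀ x ∈ U, ∀ y ∈ U, dist (f x) (f y) ≤ K * dist x y := by
    intro x hx y hy
    have h := hfU x hx y hy
    rw [hδ'] at h
    rw [dist_eq_norm, dist_eq_norm]
    have h1 : ‖f x - f y‖ ≤ ‖f x - f y - J (x - y)‖ + ‖J (x - y)‖ := by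
      simpa using norm_add_le (f x - f y - J (x - y)) (J (x - y))
    rw [hJ] at h1
    have h2 : 2 - (K : ℝ)⁻¹ ≤ K := by
      have : (K : ℝ) * (K : ℝ)⁻¹ = 1 := mul_inv_cancel₀ hKpos.ne'
      nlinarith [mul_pos hKpos (inv_pos.2 hKpos), sq_nonneg ((K : ℝ) - 1), inv_pos.2 hKpos]
    nlinarith [norm_nonneg (x - y)]
  have hlb : ∀ x ∈ U, ∀ y ∈ U, dist x y ≤ K * dist (f x) (f y) := by
    intro x hx y hy
    have h := hfU x hx y hy
    rw [hδ'] at h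
    rw [dist_eq_norm, dist_eq_norm]
    have h1 : ‖J (x - y)‖ ≤ ‖f x - f y - J (x - y)‖ + ‖f x - f y‖ := by
      have := norm_sub_le (f x - f y) (f x - f y - J (x - y))
      rw [sub_sub_cancel] at this
      linarith
    rw [hJ] at h1
    have h2 : (K : ℝ)⁻¹ * ‖x - y‖ ≤ ‖f x - f y‖ := by linarith
    rwa [inv_mul_le_iff₀ hKpos] at h2
  refine eventually_smallSets.2 ⟨U, hU, fun s hs => ⟨?_, ?_⟩⟩
  · rcases isEmpty_or_nonempty E with hE | hE
    · simp [Set.eq_empty_of_isEmpty s]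
    have hinj : Set.InjOn f s := by
      intro x hx y hy hxy
      have := hlb x (hs hx) y (hs hy)
      rw [hxy, dist_self, mul_zero] at this
      exact dist_le_zero.1 this
    have hinv : Function.invFunOn f s '' (f '' s) = s := by
      rw [Set.image_image]
      exact (Set.image_congr fun x hx => hinj.leftInvOn_invFunOn hx).trans (Set.image_id' s)
    have hlip : LipschitzOnWith K (Function.invFunOn f s) (f '' s) := by
      refine LipschitzOnWith.of_dist_le_mul ?_
      rintro _ ⟨x, hx, rfl⟩ _ ⟨y, hy, rfl⟩
      rw [hinj.leftInvOn_invFunOn hx, hinj.leftInvOn_invFunOn hy]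
      exact hlb x (hs hx) y (hs hy)
    have h := hlip.euclideanHausdorffMeasure_image_le d
    rw [hinv] at h
    exact h.trans (by gcongr)
  · have hlip : LipschitzOnWith K f s :=
      LipschitzOnWith.of_dist_le_mul fun x hx y hy => hub x (hs hx) y (hs hy)
    exact (hlip.euclideanHausdorffMeasure_image_le d).trans (by gcongr)

end LocalMeasure

/-! ### Exponential coordinates on $SPD(n)$ and $O(n)$. -/

section Exponential

open Filter Topology
open scoped NNReal

variable {n : ℕ}

/-- Extension by zero of a function on the indices strictly below the diagonal. -/
def lowerExtend (n : ℕ) :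
    ({p : Fin n × Fin n // ¬ p.1 ≤ p.2} → ℝ) →ₗ[ℝ] (Fin n × Fin n → ℝ) where
  toFun x p := if h : ¬ p.1 ≤ p.2 then x ⟨p, h⟩ else 0
  map_add' x y := by
    ext p
    simp only [Pi.add_apply]
    split_ifs <;> simp
  map_smul' c x := by
    ext p
    by_cases h : p.1 ≤ p.2 <;> simp [h, -not_le]

theorem lowerExtend_of_le (x : {p : Fin n × Fin n // ¬ p.1 ≤ p.2} → ℝ) {i j : Fin n}
    (h : i ≤ j) : lowerExtend n x (i, j) = 0 := dif_neg (not_not.2 h)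

theorem lowerExtend_of_not_le (x : {p : Fin n × Fin n // ¬ p.1 ≤ p.2} → ℝ) {i j : Fin n}
    (h : ¬ i ≤ j) : lowerExtend n x (i, j) = x ⟨(i, j), h⟩ := dif_pos h

/-- The antisymmetric matrix whose transpose has given entries below the diagonal. -/
def skewOfLower (n : ℕ) :
    ({p : Fin n × Fin n // ¬ p.1 ≤ p.2} → ℝ) →ₗ[ℝ] Matrix (Fin n) (Fin n) ℝ where
  toFun x := Matrix.of fun i j => lowerExtend n x (j, i) - lowerExtend n x (i, j)
  map_add' x y := by
    ext i j
    simp only [map_add, Pi.add_apply, Matrix.of_apply, Matrix.add_apply]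
    ring
  map_smul' c x := by
    ext i j
    simp only [map_smul, Pi.smul_apply, Matrix.of_apply, Matrix.smul_apply, RingHom.id_apply,
      smul_eq_mul]
    ring

theorem skewOfLower_apply (x : {p : Fin n × Fin n // ¬ p.1 ≤ p.2} → ℝ) (i j : Fin n) :
    skewOfLower n x i j = lowerExtend n x (j, i) - lowerExtend n x (i, j) := rfl

theorem transpose_skewOfLower (x : {p : Fin n × Fin n // ¬ p.1 ≤ p.2} → ℝ) :
    (skewOfLower n x)ᵀ = -skewOfLower n x := by
  ext i j
  simp [skewOfLower_apply]

/-- Each coordinate appears in two entries of the matrix; the scaling by $1/\sqrt2$ in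
`orthogonalVolume` removes this factor $2$. -/
theorem sum_sq_skewOfLower (x : {p : Fin n × Fin n // ¬ p.1 ≤ p.2} → ℝ) :
    ∑ p : Fin n × Fin n, skewOfLower n x p.1 p.2 ^ 2 = 2 * ∑ p, x p ^ 2 := by
  have h1 : ∀ p : Fin n × Fin n, skewOfLower n x p.1 p.2 ^ 2
      = lowerExtend n x p.swap ^ 2 + lowerExtend n x p ^ 2 := by
    rintro ⟨i, j⟩
    rw [skewOfLower_apply, Prod.swap]
    rcases le_total i j with h | h
    · rw [lowerExtend_of_le x h]; ring
    · rw [lowerExtend_of_le x h]; ring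
  have h2 : ∑ p : Fin n × Fin n, lowerExtend n x p.swap ^ 2
      = ∑ p : Fin n × Fin n, lowerExtend n x p ^ 2 :=
    (Equiv.prodComm (Fin n) (Fin n)).sum_comp fun p => lowerExtend n x p ^ 2
  have h3 : ∑ p : Fin n × Fin n, lowerExtend n x p ^ 2 = ∑ p, x p ^ 2 := by
    rw [← Fintype.sum_subtype_add_sum_subtype (fun p : Fin n × Fin n => p.1 ≤ p.2)]
    rw [Finset.sum_eq_zero, zero_add]
    · refine Finset.sum_congr rfl fun p _ => ?_
      rw [lowerExtend_of_not_le x p.2]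
    · rintro ⟨⟨i, j⟩, h⟩ _
      rw [lowerExtend_of_le x h]
      simp
  rw [Finset.sum_congr rfl fun p _ => h1 p, Finset.sum_add_distrib, h2, h3]
  ring

/-- The exponential of an antisymmetric matrix, as an orthogonal matrix. -/
noncomputable def expOrthogonal (x : {p : Fin n × Fin n // ¬ p.1 ≤ p.2} → ℝ) : OGroup n :=
  ⟨NormedSpace.exp (skewOfLower n x), by
    rw [Matrix.mem_orthogonalGroup_iff, ← Matrix.exp_transpose, transpose_skewOfLower,
      Matrix.exp_neg]
    exact Matrix.mul_nonsing_inv _ ((Matrix.isUnit_iff_isUnit_det _).1 (Matrix.isUnit_exp _))⟩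

theorem exp_two_smul (X : Matrix (Fin n) (Fin n) ℝ) :
    NormedSpace.exp ((2 : ℝ) • X) = NormedSpace.exp X * NormedSpace.exp X := by
  rw [two_smul, Matrix.exp_add_of_commute _ _ (Commute.refl X)]

/-- The exponential of a symmetric matrix, as a positive definite matrix. -/
noncomputable def expSPD (y : {p : Fin n × Fin n // p.1 ≤ p.2} → ℝ) : SPD n :=
  ⟨NormedSpace.exp (symOfUpper n y), by
    -- $\exp Y$ is the Gram matrix of the invertible symmetric matrix $\exp(Y/2)$, hence positive
    -- definite.
    have hu : IsUnit (NormedSpace.exp (symOfUpper n ((2 : ℝ)⁻¹ • y))) := Matrix.isUnit_exp _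
    have h := (gramSPD hu.unit).2
    rw [gramSPD_val, IsUnit.unit_spec, ← Matrix.exp_transpose, transpose_symOfUpper,
      ← exp_two_smul, ← map_smul, smul_inv_smul₀ two_ne_zero] at h
    exact h⟩

theorem expSPD_two_smul (y : {p : Fin n × Fin n // p.1 ≤ p.2} → ℝ) :
    expSPD ((2 : ℝ) • y) = (expSPD y).sq := by
  refine Subtype.ext ?_
  change NormedSpace.exp (symOfUpper n ((2 : ℝ) • y)) = _
  rw [map_smul, exp_two_smul]
  rfl

/-- Doubling the exponent absorbs the square root, so `CFC.sqrt` never has to be differentiated. -/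
theorem sqrt_expSPD_two_smul (y : {p : Fin n × Fin n // p.1 ≤ p.2} → ℝ) :
    (expSPD ((2 : ℝ) • y)).sqrt = expSPD y := by
  rw [expSPD_two_smul, SPD.sqrt_sq]

theorem expSPD_zero : expSPD (0 : {p : Fin n × Fin n // p.1 ≤ p.2} → ℝ) = ⟨1, PosDef.one⟩ :=
  Subtype.ext (by simp [expSPD])

open scoped Matrix.Norms.Frobenius in
theorem continuous_matrix_exp :
    Continuous (NormedSpace.exp : Matrix (Fin n) (Fin n) ℝ → Matrix (Fin n) (Fin n) ℝ) :=
  NormedSpace.exp_continuous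

theorem continuous_expSPD : Continuous (expSPD (n := n)) :=
  (continuous_matrix_exp.comp (symOfUpper n).continuous_of_finiteDimensional).subtype_mk _

theorem continuous_expOrthogonal : Continuous (expOrthogonal (n := n)) :=
  (continuous_matrix_exp.comp (skewOfLower n).continuous_of_finiteDimensional).subtype_mk _

open scoped Matrix.Norms.Frobenius in
/-- The derivative at `0` of a linear function of the exponential of a linear function. -/
theorem hasStrictFDerivAt_linearMap_exp {E F : Type*} [NormedAddCommGroup E] [NormedSpace ℝ E]
    [FiniteDimensional ℝ E] [NormedAddCommGroup F] [NormedSpace ℝ F]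
    (A : E →ₗ[ℝ] Matrix (Fin n) (Fin n) ℝ) (B : Matrix (Fin n) (Fin n) ℝ →ₗ[ℝ] F) :
    HasStrictFDerivAt (fun x => B (NormedSpace.exp (A x)))
      (LinearMap.toContinuousLinearMap (B ∘ₗ A)) 0 := by
  have hA : HasStrictFDerivAt A (LinearMap.toContinuousLinearMap A) 0 :=
    (LinearMap.toContinuousLinearMap A).hasStrictFDerivAt
  have hB : HasStrictFDerivAt B (LinearMap.toContinuousLinearMap B)
      (NormedSpace.exp (A 0)) := (LinearMap.toContinuousLinearMap B).hasStrictFDerivAt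
  have hexp : HasStrictFDerivAt
      (NormedSpace.exp : Matrix (Fin n) (Fin n) ℝ → Matrix (Fin n) (Fin n) ℝ)
      (1 : Matrix (Fin n) (Fin n) ℝ →L[ℝ] Matrix (Fin n) (Fin n) ℝ) (A 0) := by
    rw [map_zero]
    exact hasStrictFDerivAt_exp_zero
  refine (hB.comp 0 (hexp.comp 0 hA)).congr_fderiv ?_
  ext x
  rfl

open scoped Matrix.Norms.Frobenius in
/-- The derivative at `0` of a linear function of a product of two exponentials. -/
theorem hasStrictFDerivAt_linearMap_exp_mul_exp {E F : Type*} [NormedAddCommGroup E]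
    [NormedSpace ℝ E] [FiniteDimensional ℝ E] [NormedAddCommGroup F] [NormedSpace ℝ F]
    (A A' : E →ₗ[ℝ] Matrix (Fin n) (Fin n) ℝ) (B : Matrix (Fin n) (Fin n) ℝ →ₗ[ℝ] F) :
    HasStrictFDerivAt (fun x => B (NormedSpace.exp (A x) * NormedSpace.exp (A' x)))
      (LinearMap.toContinuousLinearMap (B ∘ₗ (A + A'))) 0 := by
  have hA := hasStrictFDerivAt_linearMap_exp A LinearMap.id
  have hA' := hasStrictFDerivAt_linearMap_exp A' LinearMap.id
  have hB : HasStrictFDerivAt B (LinearMap.toContinuousLinearMap B)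
      (NormedSpace.exp (A 0) * NormedSpace.exp (A' 0)) :=
    (LinearMap.toContinuousLinearMap B).hasStrictFDerivAt
  refine (hB.comp 0 (hA.mul' hA')).congr_fderiv ?_
  ext x
  simp only [map_zero, NormedSpace.exp_zero, LinearMap.id_comp, LinearMap.id_apply, one_smul,
    MulOpposite.op_one, add_comm]
  rfl

end Exponential

/-! ### Volumes of small cubes in $SPD(n)$ and $GL(n)$. -/

section LocalVolumes

open Filter Topology
open scoped NNReal

variable {n : ℕ}

theorem card_lower (n : ℕ) :
    Fintype.card {p : Fin n × Fin n // ¬ p.1 ≤ p.2} = n.choose 2 := by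
  rw [Fintype.card_subtype, Finset.card_filter, Fintype.sum_prod_type]
  have h : ∀ i : Fin n, ∑ j : Fin n, (if ¬ i ≤ j then 1 else 0) = (i : ℕ) := by
    intro i
    rw [← Finset.card_filter, ← Fin.card_Iio i]
    congr 1
    ext j
    simp
  rw [Finset.sum_congr rfl fun i _ => h i, Fin.sum_univ_eq_sum_range (fun i => i),
    Finset.sum_range_id, Nat.choose_two_right]

theorem card_upper (n : ℕ) :
    Fintype.card {p : Fin n × Fin n // p.1 ≤ p.2} = n.choose 2 + n := by
  have h1 := Fintype.card_congr (Equiv.sumCompl fun p : Fin n × Fin n => p.1 ≤ p.2)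
  rw [Fintype.card_sum, card_lower, Fintype.card_prod, Fintype.card_fin] at h1
  have h2 : n.choose 2 * 2 = n * (n - 1) := by
    rw [Nat.choose_two_right, Nat.div_mul_cancel (Nat.even_mul_pred_self n).two_dvd]
  have h3 : n * (n - 1) + n = n * n := by
    cases n with
    | zero => rfl
    | succ m => simp; ring
  omega

/-- In the coordinates $S_{ij}$, $i\le j$, the derivative at $0$ is twice the identity in dimension
$n(n-1)/2+n$, and the density is $1$ at $S=1$. -/
theorem eventually_spdMeasure_image {t : ℝ≥0} (ht : 1 < t) : ∀ᶠ r in 𝓝 (0 : ℝ),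
    2 ^ (n.choose 2 + n) * volume (Metric.closedBall
        (0 : {p : Fin n × Fin n // p.1 ≤ p.2} → ℝ) r) ≤
      t * (t * spdMeasure n ((fun y => expSPD ((2 : ℝ) • y)) '' Metric.closedBall 0 r)) ∧
    spdMeasure n ((fun y => expSPD ((2 : ℝ) • y)) '' Metric.closedBall 0 r) ≤
      t * (t * (2 ^ (n.choose 2 + n) * volume (Metric.closedBall
        (0 : {p : Fin n × Fin n // p.1 ≤ p.2} → ℝ) r))) := by
  have hcont : Continuous fun y : {p : Fin n × Fin n // p.1 ≤ p.2} → ℝ =>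
      expSPD ((2 : ℝ) • y) := continuous_expSPD.comp (continuous_const_smul _)
  have hder := hasStrictFDerivAt_linearMap_exp ((2 : ℝ) • symOfUpper n) (upperEntries n)
  have hdet : (LinearMap.toContinuousLinearMap (upperEntries n ∘ₗ ((2 : ℝ) • symOfUpper n))).det
      = 2 ^ (n.choose 2 + n) := by
    rw [LinearMap.det_toContinuousLinearMap, det_linearMap_of_diagonal _ (fun _ => 2)]
    · simp [card_upper]
    · intro y p
      simp [upperEntries_symOfUpper]
  have hw : Tendsto (fun y => ENNReal.ofReal
      (|(expSPD ((2 : ℝ) • y) : SPD n).1.det| ^ (-((n : ℝ) + 1) / 2))) (𝓝 0) (𝓝 1) := by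
    have h : Continuous fun y => ENNReal.ofReal
      (|(expSPD ((2 : ℝ) • y) : SPD n).1.det| ^ (-((n : ℝ) + 1) / 2)) := by
      refine ENNReal.continuous_ofReal.comp (Continuous.rpow_const ?_ fun y => Or.inl ?_)
      · exact (continuous_subtype_val.comp hcont).matrix_det.abs
      · exact abs_ne_zero.2 (expSPD ((2 : ℝ) • y)).2.det_pos.ne'
    have h0 := h.tendsto 0
    simpa [expSPD_zero] using h0
  have key := HasStrictFDerivAt.eventually_smallSets_withDensity_comap_image volume
    measurableEmbedding_spdEntries
    (w := fun S => ENNReal.ofReal (|S.1.det| ^ (-((n : ℝ) + 1) / 2)))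
    (g := fun y => expSPD ((2 : ℝ) • y)) hder
    (by rw [hdet]; positivity) hw ht
  filter_upwards [(tendsto_closedBall_smallSets _).eventually key] with r hr
  have hmeas := ((isCompact_closedBall (0 : {p : Fin n × Fin n // p.1 ≤ p.2} → ℝ) r).image
    hcont).measurableSet
  have h := hr hmeas
  rw [hdet, abs_of_pos (by positivity), ENNReal.ofReal_pow (by positivity),
    ENNReal.ofReal_ofNat] at h
  exact h

/-- The entries of a matrix strictly below the diagonal. -/
def lowerEntries (n : ℕ) :
    Matrix (Fin n) (Fin n) ℝ →ₗ[ℝ] ({p : Fin n × Fin n // ¬ p.1 ≤ p.2} → ℝ) where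
  toFun X p := X p.1.1 p.1.2
  map_add' _ _ := rfl
  map_smul' _ _ := rfl

/-- The sum of a symmetric and an antisymmetric matrix encoded by the upper and lower parts of a
matrix. -/
def symAddSkew (n : ℕ) : (Fin n → Fin n → ℝ) →ₗ[ℝ] (Fin n → Fin n → ℝ) :=
  (Matrix.ofLinearEquiv (m := Fin n) (n := Fin n) (α := ℝ) ℝ).symm.toLinearMap ∘ₗ
    (symOfUpper n ∘ₗ upperEntries n ∘ₗ (Matrix.ofLinearEquiv ℝ).toLinearMap +
      skewOfLower n ∘ₗ lowerEntries n ∘ₗ (Matrix.ofLinearEquiv ℝ).toLinearMap)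

theorem symAddSkew_of_lt (M : Fin n → Fin n → ℝ) {i j : Fin n} (h : i < j) :
    symAddSkew n M i j = M i j + M j i := by
  change M (min i j) (max i j) + (lowerExtend n (lowerEntries n (Matrix.of M)) (j, i) -
    lowerExtend n (lowerEntries n (Matrix.of M)) (i, j)) = _
  rw [lowerExtend_of_le _ h.le, lowerExtend_of_not_le _ h.not_ge, min_eq_left h.le,
    max_eq_right h.le, sub_zero]
  rfl

theorem symAddSkew_of_gt (M : Fin n → Fin n → ℝ) {i j : Fin n} (h : j < i) :
    symAddSkew n M i j = M j i - M i j := by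
  change M (min i j) (max i j) + (lowerExtend n (lowerEntries n (Matrix.of M)) (j, i) -
    lowerExtend n (lowerEntries n (Matrix.of M)) (i, j)) = _
  rw [lowerExtend_of_le _ h.le, lowerExtend_of_not_le _ h.not_ge, min_eq_right h.le,
    max_eq_left h.le, zero_sub, ← sub_eq_add_neg]
  rfl

theorem symAddSkew_diag (M : Fin n → Fin n → ℝ) (i : Fin n) :
    symAddSkew n M i i = M i i := by
  change M (min i i) (max i i) + (lowerExtend n (lowerEntries n (Matrix.of M)) (i, i) -
    lowerExtend n (lowerEntries n (Matrix.of M)) (i, i)) = _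
  simp

/-- The square of `symAddSkew` is diagonal: it fixes diagonal entries and doubles the $n(n-1)$
others. This gives the square of the determinant, hence its absolute value. -/
theorem abs_det_symAddSkew (n : ℕ) : |LinearMap.det (symAddSkew n)| = 2 ^ n.choose 2 := by
  have h1 : LinearMap.det (symAddSkew n ∘ₗ symAddSkew n)
      = ∏ p : Fin n × Fin n, if p.1 = p.2 then (1 : ℝ) else 2 := by
    rw [← LinearMap.det_conj _ (LinearEquiv.curry ℝ ℝ (Fin n) (Fin n)).symm,
      det_linearMap_of_diagonal _ (fun p => if p.1 = p.2 then (1 : ℝ) else 2)]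
    rintro x ⟨i, j⟩
    change symAddSkew n (symAddSkew n (Function.curry x)) i j = _
    rcases lt_trichotomy i j with h | h | h
    · rw [symAddSkew_of_lt _ h, symAddSkew_of_lt _ h, symAddSkew_of_gt _ h, if_neg h.ne]
      simp only [Function.curry]
      ring
    · subst h
      rw [symAddSkew_diag, symAddSkew_diag, if_pos rfl, one_mul]
      rfl
    · rw [symAddSkew_of_gt _ h, symAddSkew_of_lt _ h, symAddSkew_of_gt _ h, if_neg h.ne']
      simp only [Function.curry]
      ring
  have h2 : ∏ p : Fin n × Fin n, (if p.1 ≤ p.2 then (1 : ℝ) else 2) = 2 ^ n.choose 2 := by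
    rw [← card_lower, ← Fintype.prod_subtype_mul_prod_subtype (fun p : Fin n × Fin n => p.1 ≤ p.2),
      Finset.prod_eq_one fun p _ => if_pos p.2, Finset.prod_congr rfl fun p _ => if_neg p.2]
    simp
  have h3 : ∏ p : Fin n × Fin n, (if p.2 ≤ p.1 then (1 : ℝ) else 2) = 2 ^ n.choose 2 :=
    ((Equiv.prodComm (Fin n) (Fin n)).prod_comp
      fun p => if p.1 ≤ p.2 then (1 : ℝ) else 2).trans h2
  have h4 : ∏ p : Fin n × Fin n, (if p.1 = p.2 then (1 : ℝ) else 2)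
      = 2 ^ n.choose 2 * 2 ^ n.choose 2 := by
    nth_rw 1 [← h2]
    rw [← h3, ← Finset.prod_mul_distrib]
    refine Finset.prod_congr rfl ?_
    rintro ⟨i, j⟩ _
    rcases lt_trichotomy i j with h | h | h
    · simp [h.le, h.ne, h.not_ge]
    · simp [h]
    · simp [h.le, h.ne', h.not_ge]
  rw [LinearMap.det_comp, h4, ← abs_mul_abs_self] at h1
  exact (mul_self_inj (abs_nonneg _) (by positivity)).1 h1

/-- The polar map in exponential coordinates. -/
noncomputable def polarChart (n : ℕ) (M : Fin n → Fin n → ℝ) : GL (Fin n) ℝ :=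
  polarMap n (expSPD ((2 : ℝ) • upperEntries n (Matrix.of M)),
    expOrthogonal (lowerEntries n (Matrix.of M)))

theorem polarChart_val (M : Fin n → Fin n → ℝ) :
    (polarChart n M).1 = NormedSpace.exp (symOfUpper n (upperEntries n (Matrix.of M))) *
      NormedSpace.exp (skewOfLower n (lowerEntries n (Matrix.of M))) := by
  rw [polarChart, polarMap_val, sqrt_expSPD_two_smul]
  rfl

theorem continuous_polarChart : Continuous (polarChart n) := by
  rw [isOpenEmbedding_glVal.isInducing.continuous_iff]
  have h : Continuous fun M : Fin n → Fin n → ℝ => (polarChart n M).1 := by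
    simp only [polarChart_val]
    refine Continuous.matrix_mul ?_ ?_
    · exact continuous_matrix_exp.comp (symOfUpper n ∘ₗ upperEntries n ∘ₗ
        (Matrix.ofLinearEquiv ℝ).toLinearMap).continuous_of_finiteDimensional
    · exact continuous_matrix_exp.comp (skewOfLower n ∘ₗ lowerEntries n ∘ₗ
        (Matrix.ofLinearEquiv ℝ).toLinearMap).continuous_of_finiteDimensional
  exact h

theorem hasStrictFDerivAt_polarChart : HasStrictFDerivAt
    (fun (M : Fin n → Fin n → ℝ) (i j : Fin n) => (polarChart n M).1 i j)
    (LinearMap.toContinuousLinearMap (symAddSkew n)) 0 := by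
  simp only [polarChart_val]
  exact hasStrictFDerivAt_linearMap_exp_mul_exp (E := Fin n → Fin n → ℝ) (F := Fin n → Fin n → ℝ)
    (symOfUpper n ∘ₗ upperEntries n ∘ₗ (Matrix.ofLinearEquiv ℝ).toLinearMap)
    (skewOfLower n ∘ₗ lowerEntries n ∘ₗ (Matrix.ofLinearEquiv ℝ).toLinearMap)
    (Matrix.ofLinearEquiv ℝ).symm.toLinearMap

theorem polarChart_zero : polarChart n 0 = 1 := by
  refine Units.ext ?_
  rw [polarChart_val]
  simp [show Matrix.of (0 : Fin n → Fin n → ℝ) = 0 from rfl]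

/-- The derivative of the chart at $0$ is `symAddSkew`, and the density is $1$ at the identity. -/
theorem eventually_glHaar_image {t : ℝ≥0} (ht : 1 < t) : ∀ᶠ r in 𝓝 (0 : ℝ),
    2 ^ n.choose 2 * volume (Metric.closedBall (0 : Fin n → Fin n → ℝ) r) ≤
      t * (t * glHaar n (polarChart n '' Metric.closedBall 0 r)) ∧
    glHaar n (polarChart n '' Metric.closedBall 0 r) ≤
      t * (t * (2 ^ n.choose 2 * volume (Metric.closedBall (0 : Fin n → Fin n → ℝ) r))) := by
  have hdet : |(LinearMap.toContinuousLinearMap (symAddSkew n)).det| = 2 ^ n.choose 2 := by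
    rw [LinearMap.det_toContinuousLinearMap, abs_det_symAddSkew]
  have hw : Tendsto (fun M => ENNReal.ofReal (|(polarChart n M).1.det| ^ n)⁻¹)
      (𝓝 0) (𝓝 1) := by
    have h : Continuous fun M => ENNReal.ofReal (|(polarChart n M).1.det| ^ n)⁻¹ :=
      ENNReal.continuous_ofReal.comp (continuous_glDensity.comp continuous_polarChart)
    have h0 := h.tendsto 0
    simpa [polarChart_zero] using h0
  have key := HasStrictFDerivAt.eventually_smallSets_withDensity_comap_image volume
    isOpenEmbedding_glEntries.measurableEmbedding
    (w := fun A => ENNReal.ofReal (|A.1.det| ^ n)⁻¹) hasStrictFDerivAt_polarChart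
    (by rw [← abs_pos, hdet]; positivity) hw ht
  filter_upwards [(tendsto_closedBall_smallSets _).eventually key] with r hr
  have h := hr ((isCompact_closedBall (0 : Fin n → Fin n → ℝ) r).image
    continuous_polarChart).measurableSet
  rw [hdet, ENNReal.ofReal_pow (by positivity), ENNReal.ofReal_ofNat] at h
  exact h

theorem volume_closedBall_entries {r : ℝ} (hr : 0 ≤ r) :
    volume (Metric.closedBall (0 : Fin n → Fin n → ℝ) r) =
      volume (Metric.closedBall (0 : {p : Fin n × Fin n // p.1 ≤ p.2} → ℝ) r) *
      volume (Metric.closedBall (0 : {p : Fin n × Fin n // ¬ p.1 ≤ p.2} → ℝ) r) := by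
  have hcard := Fintype.card_congr (Equiv.sumCompl fun p : Fin n × Fin n => p.1 ≤ p.2)
  rw [Fintype.card_sum, Fintype.card_prod, Fintype.card_fin] at hcard
  rw [Real.volume_pi_closedBall _ hr, Real.volume_pi_closedBall _ hr,
    MeasureTheory.volume_pi_closedBall _ hr, ← ENNReal.ofReal_mul (by positivity), ← pow_add,
    hcard]
  simp only [Real.volume_pi_closedBall _ hr, Finset.prod_const, Finset.card_univ,
    Fintype.card_fin]
  rw [← ENNReal.ofReal_pow (by positivity), ← pow_mul]

/-- Balls for the sup norm are cubes, so a ball of matrices is the product of the balls of its upper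
and lower entries. Its image is therefore the polar image of a measurable rectangle. -/
theorem image_polarChart_closedBall {r : ℝ} (hr : 0 ≤ r) :
    polarChart n '' Metric.closedBall 0 r = polarMap n ''
      (((fun y => expSPD ((2 : ℝ) • y)) '' Metric.closedBall 0 r) ×ˢ
        (expOrthogonal '' Metric.closedBall 0 r)) := by
  ext A
  constructor
  · rintro ⟨M, hM, rfl⟩
    rw [mem_closedBall_zero_iff, pi_norm_le_iff_of_nonneg hr] at hM
    have hM' : ∀ i j, ‖M i j‖ ≤ r := fun i j => (pi_norm_le_iff_of_nonneg hr).1 (hM i) j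
    refine ⟨_, ⟨⟨_, ?_, rfl⟩, ⟨_, ?_, rfl⟩⟩, rfl⟩
    · rw [mem_closedBall_zero_iff, pi_norm_le_iff_of_nonneg hr]
      exact fun p => hM' _ _
    · rw [mem_closedBall_zero_iff, pi_norm_le_iff_of_nonneg hr]
      exact fun p => hM' _ _
  · rintro ⟨⟨S, R⟩, ⟨⟨y, hy, rfl⟩, ⟨x, hx, rfl⟩⟩, rfl⟩
    rw [mem_closedBall_zero_iff, pi_norm_le_iff_of_nonneg hr] at hx hy
    refine ⟨fun i j => if h : i ≤ j then y ⟨(i, j), h⟩ else x ⟨(i, j), h⟩, ?_, ?_⟩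
    · rw [mem_closedBall_zero_iff, pi_norm_le_iff_of_nonneg hr]
      refine fun i => (pi_norm_le_iff_of_nonneg hr).2 fun j => ?_
      split_ifs
      · exact hy _
      · exact hx _
    · have h1 : upperEntries n (Matrix.of fun i j =>
          if h : i ≤ j then y ⟨(i, j), h⟩ else x ⟨(i, j), h⟩) = y := by
        ext p
        exact dif_pos p.2
      have h2 : lowerEntries n (Matrix.of fun i j =>
          if h : i ≤ j then y ⟨(i, j), h⟩ else x ⟨(i, j), h⟩) = x := by
        ext p
        exact dif_neg p.2
      rw [polarChart, h1, h2]

end LocalVolumes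

/-! ### The Riemannian volume of $O(n)$ as a Haar measure. -/

section OrthogonalVolume

open Filter Topology
open scoped NNReal

variable {n : ℕ}

/-- The linear embedding `X ↦ X / √2` of matrices into Euclidean space. -/
noncomputable def matrixToEuclidean (n : ℕ) :
    Matrix (Fin n) (Fin n) ℝ →ₗ[ℝ] EuclideanSpace ℝ (Fin n × Fin n) where
  toFun X := WithLp.toLp 2 fun p => X p.1 p.2 / √2
  map_add' X Y := by
    ext p
    simp [add_div]
  map_smul' c X := by
    ext p
    simp [mul_div_assoc]

theorem matrixToEuclidean_apply (X : Matrix (Fin n) (Fin n) ℝ) (p : Fin n × Fin n) :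
    matrixToEuclidean n X p = X p.1 p.2 / √2 := rfl

theorem norm_sq_matrixToEuclidean (X : Matrix (Fin n) (Fin n) ℝ) :
    ‖matrixToEuclidean n X‖ ^ 2 = (Xᵀ * X).trace / 2 := by
  rw [EuclideanSpace.norm_sq_eq, Matrix.trace, Fintype.sum_prod_type_right, Finset.sum_div]
  refine Finset.sum_congr rfl fun j _ => ?_
  rw [diag_apply, mul_apply, Finset.sum_div]
  refine Finset.sum_congr rfl fun i _ => ?_
  rw [matrixToEuclidean_apply, Real.norm_eq_abs, sq_abs, div_pow, Real.sq_sqrt zero_le_two,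
    transpose_apply, sq]

theorem injective_matrixToEuclidean : Function.Injective (matrixToEuclidean n) := by
  intro X Y h
  ext i j
  have h1 : X i j / √2 = Y i j / √2 := congrFun (congrArg WithLp.ofLp h) (i, j)
  exact (div_left_inj' (by positivity)).1 h1

theorem continuous_matrixToEuclidean : Continuous (matrixToEuclidean n) :=
  (matrixToEuclidean n).continuous_of_finiteDimensional

/-- The embedding `R ↦ R / √2` of the orthogonal group into Euclidean space. -/
noncomputable def orthogonalToEuclidean (R : OGroup n) : EuclideanSpace ℝ (Fin n × Fin n) :=
  matrixToEuclidean n R.1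

theorem continuous_orthogonalToEuclidean : Continuous (orthogonalToEuclidean (n := n)) :=
  continuous_matrixToEuclidean.comp continuous_subtype_val

theorem measurableEmbedding_orthogonalToEuclidean :
    MeasurableEmbedding (orthogonalToEuclidean (n := n)) :=
  (continuous_orthogonalToEuclidean.isClosedEmbedding
    (injective_matrixToEuclidean.comp Subtype.val_injective)).measurableEmbedding

/-- The Riemannian volume measure of `O(n)`. -/
noncomputable def orthogonalVolumeMeasure (n : ℕ) : Measure (OGroup n) :=
  (μHE[n.choose 2]).comap orthogonalToEuclidean

theorem orthogonalVolumeMeasure_apply (s : Set (OGroup n)) :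
    orthogonalVolumeMeasure n s = μHE[n.choose 2] (orthogonalToEuclidean '' s) :=
  measurableEmbedding_orthogonalToEuclidean.comap_apply _ _

theorem orthogonalVolumeMeasure_univ :
    orthogonalVolumeMeasure n Set.univ = orthogonalVolume n := by
  rw [orthogonalVolumeMeasure_apply, Set.image_univ]
  rfl

theorem isometry_orthogonal_mul (Q : OGroup n) (X Y : Matrix (Fin n) (Fin n) ℝ) :
    dist (matrixToEuclidean n (Q.1 * X)) (matrixToEuclidean n (Q.1 * Y)) =
      dist (matrixToEuclidean n X) (matrixToEuclidean n Y) := by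
  have hQ : Q.1ᵀ * Q.1 = 1 := (Matrix.mem_orthogonalGroup_iff' (Fin n) ℝ).1 Q.2
  rw [dist_eq_norm, dist_eq_norm, ← map_sub, ← map_sub, ← Matrix.mul_sub]
  refine (sq_eq_sq₀ (norm_nonneg _) (norm_nonneg _)).1 ?_
  rw [norm_sq_matrixToEuclidean, norm_sq_matrixToEuclidean, transpose_mul, Matrix.mul_assoc,
    ← Matrix.mul_assoc Q.1ᵀ, hQ, Matrix.one_mul]

theorem surjective_matrixToEuclidean : Function.Surjective (matrixToEuclidean n) := by
  intro v
  refine ⟨Matrix.of fun i j => v (i, j) * √2, ?_⟩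
  ext p
  rw [matrixToEuclidean_apply, of_apply, mul_div_cancel_right₀ _ (by positivity)]

theorem isMulLeftInvariant_orthogonalVolumeMeasure :
    (orthogonalVolumeMeasure n).IsMulLeftInvariant := by
  have key : ∀ (Q : OGroup n) (t : Set (OGroup n)),
      orthogonalVolumeMeasure n ((fun R => Q * R) '' t) = orthogonalVolumeMeasure n t := by
    intro Q t
    have hinv := Function.rightInverse_surjInv (surjective_matrixToEuclidean (n := n))
    set inv := Function.surjInv (surjective_matrixToEuclidean (n := n))
    -- Left multiplication by $Q$ is transported to an isometry of the whole Euclidean space, and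
    -- isometries preserve Hausdorff measure.
    have hT : Isometry fun v => matrixToEuclidean n (Q.1 * inv v) := by
      refine Isometry.of_dist_eq fun v w => ?_
      rw [isometry_orthogonal_mul, hinv v, hinv w]
    rw [orthogonalVolumeMeasure_apply, orthogonalVolumeMeasure_apply,
      ← hT.euclideanHausdorffMeasure_image (orthogonalToEuclidean '' t), Set.image_image,
      Set.image_image]
    congr 1
    refine Set.image_congr fun R _ => ?_
    have h : inv (orthogonalToEuclidean R) = R.1 := injective_matrixToEuclidean (hinv _)
    rw [h]
    rfl
  refine ⟨fun Q => ?_⟩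
  ext s hs
  rw [Measure.map_apply (measurable_const_mul Q) hs, ← key Q,
    Set.image_preimage_eq _ (mul_left_surjective Q)]

theorem norm_matrixToEuclidean_skewOfLower
    (x : EuclideanSpace ℝ {p : Fin n × Fin n // ¬ p.1 ≤ p.2}) :
    ‖matrixToEuclidean n (skewOfLower n (WithLp.ofLp x))‖ = ‖x‖ := by
  refine (sq_eq_sq₀ (norm_nonneg _) (norm_nonneg _)).1 ?_
  rw [EuclideanSpace.norm_sq_eq, EuclideanSpace.norm_sq_eq]
  simp only [matrixToEuclidean_apply, Real.norm_eq_abs, sq_abs, div_pow,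
    Real.sq_sqrt zero_le_two]
  rw [← Finset.sum_div, sum_sq_skewOfLower]
  ring

/-- The derivative of $x\mapsto\exp(X)/\sqrt2$ at $0$ is isometric for the Euclidean norm on $x$, so
the local factor is $1$. -/
theorem eventually_orthogonalVolumeMeasure_image {t : ℝ≥0} (ht : 1 < t) :
    ∀ᶠ r in 𝓝 (0 : ℝ),
    volume (Metric.closedBall (0 : {p : Fin n × Fin n // ¬ p.1 ≤ p.2} → ℝ) r) ≤
      t * orthogonalVolumeMeasure n (expOrthogonal '' Metric.closedBall 0 r) ∧
    orthogonalVolumeMeasure n (expOrthogonal '' Metric.closedBall 0 r) ≤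
      t * volume (Metric.closedBall (0 : {p : Fin n × Fin n // ¬ p.1 ≤ p.2} → ℝ) r) := by
  have hder := hasStrictFDerivAt_linearMap_exp
    (skewOfLower n ∘ₗ (WithLp.linearEquiv 2 ℝ
      ({p : Fin n × Fin n // ¬ p.1 ≤ p.2} → ℝ)).toLinearMap) (matrixToEuclidean n)
  have key := HasStrictFDerivAt.eventually_smallSets_euclideanHausdorffMeasure_image hder
    norm_matrixToEuclidean_skewOfLower (n.choose 2) ht
  have hsmall : Tendsto (fun r => (WithLp.toLp 2) '' Metric.closedBall
      (0 : {p : Fin n × Fin n // ¬ p.1 ≤ p.2} → ℝ) r) (𝓝 0)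
      (𝓝 (0 : EuclideanSpace ℝ {p : Fin n × Fin n // ¬ p.1 ≤ p.2})).smallSets := by
    have h := ((PiLp.continuous_toLp 2 fun _ : {p : Fin n × Fin n // ¬ p.1 ≤ p.2} => ℝ).tendsto
      0).image_smallSets
    exact h.comp (tendsto_closedBall_smallSets 0)
  -- In top dimension the normalized Hausdorff measure is Lebesgue measure, which does not depend on
  -- whether the coordinates carry the Euclidean or the sup norm.
  have hvol : ∀ r : ℝ, μHE[n.choose 2] ((WithLp.toLp 2) '' Metric.closedBall
      (0 : {p : Fin n × Fin n // ¬ p.1 ≤ p.2} → ℝ) r) =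
      volume (Metric.closedBall (0 : {p : Fin n × Fin n // ¬ p.1 ≤ p.2} → ℝ) r) := by
    intro r
    have hfin : Module.finrank ℝ (EuclideanSpace ℝ {p : Fin n × Fin n // ¬ p.1 ≤ p.2})
        = n.choose 2 := by rw [finrank_euclideanSpace, card_lower]
    rw [← hfin, InnerProductSpace.euclideanHausdorffMeasure_eq_volume,
      ← (PiLp.volume_preserving_ofLp _).measure_preimage
        Metric.isClosed_closedBall.measurableSet.nullMeasurableSet]
    congr 1
    exact (WithLp.equiv 2 _).symm.image_eq_preimage_symm _
  filter_upwards [hsmall.eventually key] with r hr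
  rw [hvol, Set.image_image] at hr
  rw [orthogonalVolumeMeasure_apply, Set.image_image]
  exact hr

/-- The chart of $GL(n)$ is open at $0$, its derivative being onto. An orthogonal $R$ near $1$ is
thus $\exp(Y)\exp(X)$ with small $Y,X$; compared with $R=1\cdot R$, uniqueness of polar
decomposition forces $R=\exp X$. -/
theorem expOrthogonal_image_mem_nhds {r : ℝ} (hr : 0 < r) :
    expOrthogonal '' Metric.closedBall 0 r ∈ 𝓝 (1 : OGroup n) := by
  have hsurj : (LinearMap.toContinuousLinearMap (symAddSkew n)).range = ⊤ := by
    have h : LinearMap.det (symAddSkew n) ≠ 0 := by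
      rw [← abs_pos, abs_det_symAddSkew]
      positivity
    exact LinearMap.range_eq_top.2 (LinearMap.equivOfDetNeZero _ h).surjective
  have hmap := hasStrictFDerivAt_polarChart.map_nhds_eq_of_surj hsurj
  have hmem : (fun (M : Fin n → Fin n → ℝ) (i j : Fin n) => (polarChart n M).1 i j) ''
      Metric.closedBall 0 r ∈ 𝓝 fun i j => (1 : Matrix (Fin n) (Fin n) ℝ) i j := by
    have h := image_mem_map (m := fun (M : Fin n → Fin n → ℝ) (i j : Fin n) =>
      (polarChart n M).1 i j) (Metric.closedBall_mem_nhds (0 : Fin n → Fin n → ℝ) hr)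
    rw [hmap, polarChart_zero] at h
    exact h
  have hcont : Continuous fun (R : OGroup n) (i j : Fin n) => R.1 i j :=
    continuous_subtype_val
  refine Filter.mem_of_superset (hcont.continuousAt.preimage_mem_nhds hmem) ?_
  rintro R ⟨M, hM, hMR⟩
  have hA : polarChart n M = polarMap n (expSPD ((2 : ℝ) • 0), R) := by
    refine Units.ext ?_
    rw [polarMap_val, sqrt_expSPD_two_smul, expSPD_zero, Matrix.one_mul]
    exact hMR
  have hM' : polarChart n M ∈ polarChart n '' Metric.closedBall 0 r := ⟨M, hM, rfl⟩
  rw [image_polarChart_closedBall hr.le, hA] at hM'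
  obtain ⟨⟨S, Q⟩, ⟨_, hQ⟩, hSQ⟩ := hM'
  have h : Q = R := congrArg Prod.snd (bijective_polarMap.1 hSQ)
  exact h ▸ hQ

theorem volume_closedBall_pi_pos_lt_top {ι : Type*} [Fintype ι] {r : ℝ} (hr : 0 < r) :
    volume (Metric.closedBall (0 : ι → ℝ) r) ≠ 0 ∧
      volume (Metric.closedBall (0 : ι → ℝ) r) ≠ ∞ :=
  ⟨(Metric.measure_closedBall_pos _ _ hr).ne', measure_closedBall_lt_top.ne⟩

/-- For a left-invariant measure, one compact neighbourhood of $1$ of positive finite measure is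
enough; a small exponential cube is one. -/
theorem isHaarMeasure_orthogonalVolumeMeasure : (orthogonalVolumeMeasure n).IsHaarMeasure := by
  have := isMulLeftInvariant_orthogonalVolumeMeasure (n := n)
  obtain ⟨r, ⟨h1, h2⟩, hr⟩ := ((eventually_orthogonalVolumeMeasure_image (n := n)
    (t := 2) one_lt_two).filter_mono nhdsWithin_le_nhds).and
    (self_mem_nhdsWithin (s := Set.Ioi (0 : ℝ))) |>.exists
  obtain ⟨h3, h4⟩ := volume_closedBall_pi_pos_lt_top
    (ι := {p : Fin n × Fin n // ¬ p.1 ≤ p.2}) hr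
  refine Measure.isHaarMeasure_of_isCompact_nonempty_interior _
    (expOrthogonal '' Metric.closedBall 0 r)
    ((isCompact_closedBall _ _).image continuous_expOrthogonal)
    ⟨1, mem_interior_iff_mem_nhds.2 (expOrthogonal_image_mem_nhds hr)⟩ (fun h => ?_) ?_
  · rw [h, mul_zero] at h1
    exact h3 (le_zero_iff.1 h1)
  · exact (h2.trans_lt (ENNReal.mul_lt_top ENNReal.coe_lt_top h4.lt_top)).ne

theorem orthogonalVolume_ne_zero : orthogonalVolume n ≠ 0 := by
  have := isHaarMeasure_orthogonalVolumeMeasure (n := n)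
  rw [← orthogonalVolumeMeasure_univ]
  exact isOpen_univ.measure_ne_zero _ Set.univ_nonempty

theorem orthogonalVolume_ne_top : orthogonalVolume n ≠ ∞ := by
  have := isHaarMeasure_orthogonalVolumeMeasure (n := n)
  rw [← orthogonalVolumeMeasure_univ]
  exact isCompact_univ.measure_lt_top.ne

theorem orthogonalVolumeMeasure_eq_smul (μO : Measure (OGroup n)) [μO.IsHaarMeasure]
    [IsProbabilityMeasure μO] : orthogonalVolumeMeasure n = orthogonalVolume n • μO := by
  have := isHaarMeasure_orthogonalVolumeMeasure (n := n)
  have h := Measure.isMulInvariant_eq_smul_of_compactSpace (orthogonalVolumeMeasure n) μO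
  have h1 : ∀ s, orthogonalVolumeMeasure n s
      = Measure.haarScalarFactor (orthogonalVolumeMeasure n) μO * μO s :=
    fun s => congrArg (fun μ => μ s) h
  have h2 := h1 Set.univ
  rw [orthogonalVolumeMeasure_univ, measure_univ, mul_one] at h2
  ext s
  rw [h1 s, h2]
  rfl

end OrthogonalVolume

/-! ### The constant $\beta_n$ and the integration formulas. -/

section PolarMeasure

open Filter Topology
open scoped NNReal

variable {n : ℕ}

/-- Let $t\to1^+$; this removes the distortion factors of the local estimates. -/
theorem le_of_forall_one_lt_le_pow_mul {a b : ℝ≥0∞} (k : ℕ)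
    (h : ∀ t : ℝ≥0, 1 < t → a ≤ (t : ℝ≥0∞) ^ k * b) : a ≤ b := by
  rcases eq_or_ne b ∞ with rfl | hb
  · exact le_top
  have h1 : Tendsto (fun t : ℝ≥0 => (t : ℝ≥0∞) ^ k * b) (𝓝[>] 1) (𝓝 (1 * b)) := by
    refine ENNReal.Tendsto.mul_const ?_ (Or.inr hb)
    have h2 : Tendsto (fun t : ℝ≥0 => ((t ^ k : ℝ≥0) : ℝ≥0∞)) (𝓝 1) (𝓝 ((1 ^ k : ℝ≥0) : ℝ≥0∞)) :=
      ENNReal.tendsto_coe.2 ((continuous_pow k).tendsto 1)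
    simp only [ENNReal.coe_pow, one_pow, ENNReal.coe_one] at h2
    exact h2.mono_left nhdsWithin_le_nhds
  rw [one_mul] at h1
  exact ge_of_tendsto h1 (by filter_upwards [self_mem_nhdsWithin] with t ht using h t ht)

/-- Comparing the volumes of small sets near the identity determines the proportionality
constant. -/
theorem smul_const_mul_orthogonalVolume (μO : Measure (OGroup n)) [μO.IsHaarMeasure]
    [IsProbabilityMeasure μO] {c : ℝ≥0}
    (hc : ((spdMeasure n).prod μO).map (polarMap n) = c • glHaar n) :
    c * orthogonalVolume n = 2 ^ n := by
  have hrect : ∀ r : ℝ, 0 ≤ r →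
      spdMeasure n ((fun y => expSPD ((2 : ℝ) • y)) '' Metric.closedBall 0 r) *
        orthogonalVolumeMeasure n (expOrthogonal '' Metric.closedBall 0 r) =
      c * orthogonalVolume n * glHaar n (polarChart n '' Metric.closedBall 0 r) := by
    intro r hr
    have hG : MeasurableSet (polarChart n '' Metric.closedBall 0 r) :=
      ((isCompact_closedBall _ _).image continuous_polarChart).measurableSet
    have h := congrArg (fun μ => μ (polarChart n '' Metric.closedBall 0 r)) hc
    simp only [Measure.map_apply measurable_polarMap hG, Measure.smul_apply, ENNReal.smul_def,
      smul_eq_mul] at h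
    rw [image_polarChart_closedBall hr, Set.preimage_image_eq _ bijective_polarMap.1,
      Measure.prod_prod, ← image_polarChart_closedBall hr] at h
    rw [orthogonalVolumeMeasure_eq_smul μO, Measure.smul_apply, smul_eq_mul, mul_left_comm, h]
    ring
  have hpow : (2 : ℝ≥0∞) ^ (n.choose 2 + n) = 2 ^ n * 2 ^ n.choose 2 := by
    rw [pow_add, mul_comm]
  -- The exponent $5$ adds the losses of the three estimates: $t^2$ for $SPD(n)$, $t$ for $O(n)$ and
  -- $t^2$ for $GL(n)$.
  have hlocal : ∀ t : ℝ≥0, 1 < t → 2 ^ n ≤ (t : ℝ≥0∞) ^ 5 * (c * orthogonalVolume n) ∧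
      c * orthogonalVolume n ≤ (t : ℝ≥0∞) ^ 5 * 2 ^ n := by
    intro t ht
    obtain ⟨r, ⟨⟨h1, h1'⟩, ⟨h2, h2'⟩, ⟨h3, h3'⟩⟩, hr⟩ :=
      (((eventually_spdMeasure_image (n := n) ht).and
        ((eventually_orthogonalVolumeMeasure_image (n := n) ht).and
          (eventually_glHaar_image (n := n) ht))).filter_mono nhdsWithin_le_nhds).and
      (self_mem_nhdsWithin (s := Set.Ioi (0 : ℝ))) |>.exists
    have hr' : 0 < r := hr
    specialize hrect r hr'.le
    rw [volume_closedBall_entries hr'.le] at h3 h3'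
    rw [hpow] at h1 h1'
    obtain ⟨ha, ha'⟩ := volume_closedBall_pi_pos_lt_top
      (ι := {p : Fin n × Fin n // p.1 ≤ p.2}) hr'
    obtain ⟨hb, hb'⟩ := volume_closedBall_pi_pos_lt_top
      (ι := {p : Fin n × Fin n // ¬ p.1 ≤ p.2}) hr'
    set a := volume (Metric.closedBall (0 : {p : Fin n × Fin n // p.1 ≤ p.2} → ℝ) r)
    set b := volume (Metric.closedBall (0 : {p : Fin n × Fin n // ¬ p.1 ≤ p.2} → ℝ) r)
    set σ := spdMeasure n ((fun y => expSPD ((2 : ℝ) • y)) '' Metric.closedBall 0 r)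
    set ν := orthogonalVolumeMeasure n (expOrthogonal '' Metric.closedBall 0 r)
    set γ := glHaar n (polarChart n '' Metric.closedBall 0 r)
    set V := (c : ℝ≥0∞) * orthogonalVolume n
    set T := (t : ℝ≥0∞)
    have hq0 : 2 ^ n.choose 2 * (a * b) ≠ 0 := by
      simp [ha, hb]
    have hqt : 2 ^ n.choose 2 * (a * b) ≠ ∞ :=
      ENNReal.mul_ne_top (by simp) (ENNReal.mul_ne_top ha' hb')
    have ht0 : T ≠ 0 := by simpa [T] using (one_pos.trans ht).ne'
    have htt : T ≠ ∞ := ENNReal.coe_ne_top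
    constructor
    · refine (ENNReal.mul_le_mul_iff_left hq0 hqt).1 ?_
      calc 2 ^ n * (2 ^ n.choose 2 * (a * b)) = (2 ^ n * 2 ^ n.choose 2 * a) * b := by ring
        _ ≤ (T * (T * σ)) * (T * ν) := mul_le_mul' h1 h2
        _ = T ^ 3 * (σ * ν) := by ring
        _ = T ^ 3 * (V * γ) := by rw [hrect]
        _ ≤ T ^ 3 * (V * (T * (T * (2 ^ n.choose 2 * (a * b))))) := by gcongr
        _ = T ^ 5 * V * (2 ^ n.choose 2 * (a * b)) := by ring
    · refine (ENNReal.mul_le_mul_iff_left hq0 hqt).1 ?_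
      calc V * (2 ^ n.choose 2 * (a * b)) ≤ V * (T * (T * γ)) := by gcongr
        _ = T ^ 2 * (V * γ) := by ring
        _ = T ^ 2 * (σ * ν) := by rw [hrect]
        _ ≤ T ^ 2 * ((T * (T * (2 ^ n * 2 ^ n.choose 2 * a))) * (T * b)) := by gcongr
        _ = T ^ 5 * 2 ^ n * (2 ^ n.choose 2 * (a * b)) := by ring
  exact le_antisymm (le_of_forall_one_lt_le_pow_mul 5 fun t ht => (hlocal t ht).2)
    (le_of_forall_one_lt_le_pow_mul 5 fun t ht => (hlocal t ht).1)

theorem polarConstant_ne_zero : polarConstant n ≠ 0 :=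
  (ENNReal.div_pos orthogonalVolume_ne_zero (by simp)).ne'

theorem polarConstant_ne_top : polarConstant n ≠ ∞ :=
  ENNReal.div_ne_top orthogonalVolume_ne_top (by simp)

theorem measurePreserving_polarMap (μO : Measure (OGroup n)) [μO.IsHaarMeasure]
    [IsProbabilityMeasure μO] :
    MeasurePreserving (polarMap n) (polarConstant n • (spdMeasure n).prod μO) (glHaar n) := by
  refine ⟨measurable_polarMap, ?_⟩
  obtain ⟨c, hc⟩ := exists_map_polarMap_eq_smul (n := n) μO
  have h := smul_const_mul_orthogonalVolume μO hc
  rw [Measure.map_smul, hc, polarConstant]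
  ext s
  rw [Measure.smul_apply, Measure.smul_apply, ENNReal.smul_def, smul_eq_mul, smul_eq_mul,
    div_eq_mul_inv, show orthogonalVolume n * (2 ^ n)⁻¹ * (c * glHaar n s)
      = c * orthogonalVolume n * (2 ^ n)⁻¹ * glHaar n s by ring, h,
    ENNReal.mul_inv_cancel (by simp) (by simp), one_mul]

/-! ### Restriction to $SO(n)$ and $GL^+(n)$. -/

section SpecialOrthogonal

/-- The inclusion of `SO(n)` into `O(n)`, as a homomorphism. -/
def specialOrthogonalInclusion (n : ℕ) : SOGroup n →* OGroup n where
  toFun := SOGroup.toO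
  map_one' := rfl
  map_mul' _ _ := rfl

/-- An orthogonal determinant squares to $1$, so positivity already forces $\det R=1$; in this form
the range is visibly open. -/
theorem range_specialOrthogonalInclusion :
    Set.range (specialOrthogonalInclusion n) = {R : OGroup n | 0 < R.1.det} := by
  ext R
  constructor
  · rintro ⟨Q, rfl⟩
    change 0 < Q.1.det
    rw [(Matrix.mem_specialOrthogonalGroup_iff.1 Q.2).2]
    exact one_pos
  · intro h
    have hR := congrArg Matrix.det R.mul_transpose
    rw [det_mul, det_transpose, det_one] at hR
    have h1 : R.1.det = 1 := by
      have h0 : 0 < R.1.det := h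
      nlinarith
    exact ⟨⟨R.1, Matrix.mem_specialOrthogonalGroup_iff.2 ⟨R.2, h1⟩⟩, rfl⟩

theorem isOpenEmbedding_specialOrthogonalInclusion :
    IsOpenEmbedding (specialOrthogonalInclusion n) := by
  refine ⟨⟨⟨?_⟩, ?_⟩, ?_⟩
  · change instTopologicalSpaceSubtype = _
    rw [instTopologicalSpaceSubtype, instTopologicalSpaceSubtype, induced_compose]
    rfl
  · intro R Q h
    exact Subtype.ext (congrArg (fun R : OGroup n => R.1) h)
  · rw [range_specialOrthogonalInclusion]
    exact isOpen_lt continuous_const continuous_subtype_val.matrix_det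

instance compactSpace_specialOrthogonalGroup : CompactSpace (SOGroup n) := by
  have h : IsClosedEmbedding (specialOrthogonalInclusion n) := by
    refine ⟨isOpenEmbedding_specialOrthogonalInclusion.isEmbedding, ?_⟩
    have : Set.range (specialOrthogonalInclusion n) = {R : OGroup n | R.1.det = 1} := by
      ext R
      constructor
      · rintro ⟨Q, rfl⟩
        exact (Matrix.mem_specialOrthogonalGroup_iff.1 Q.2).2
      · intro h
        exact ⟨⟨R.1, Matrix.mem_specialOrthogonalGroup_iff.2 ⟨R.2, h⟩⟩, rfl⟩
    rw [this]
    exact isClosed_eq continuous_subtype_val.matrix_det continuous_const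
  exact h.compactSpace

instance isTopologicalGroup_specialOrthogonalGroup : IsTopologicalGroup (SOGroup n) :=
  isOpenEmbedding_specialOrthogonalInclusion.isInducing.topologicalGroup _

/-- A reflection in `O(n)`. -/
def orthogonalReflection (hn : 1 ≤ n) : OGroup n :=
  ⟨diagonal (Function.update 1 ⟨0, hn⟩ (-1)), by
    rw [Matrix.mem_orthogonalGroup_iff, diagonal_transpose, diagonal_mul_diagonal,
      ← diagonal_one]
    congr 1
    ext i
    by_cases h : i = ⟨0, hn⟩
    · subst h; simp
    · simp [h]⟩

theorem det_orthogonalReflection (hn : 1 ≤ n) : (orthogonalReflection hn).1.det = -1 := by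
  rw [orthogonalReflection, det_diagonal, Finset.prod_update_of_mem (Finset.mem_univ _)]
  simp

/-- Left multiplication by a reflection exchanges the two components, so they have equal measure.
The reflection exists because $n\ge1$. -/
theorem measure_range_specialOrthogonalInclusion (hn : 1 ≤ n) (μO : Measure (OGroup n))
    [μO.IsMulLeftInvariant] [IsProbabilityMeasure μO] :
    μO (Set.range (specialOrthogonalInclusion n)) = 2⁻¹ := by
  have hopen : MeasurableSet {R : OGroup n | 0 < R.1.det} :=
    (isOpen_lt continuous_const continuous_subtype_val.matrix_det).measurableSet
  have hcompl : {R : OGroup n | 0 < R.1.det}ᶜ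
      = (fun R => orthogonalReflection hn * R) ⁻¹' {R : OGroup n | 0 < R.1.det} := by
    ext R
    have h0 := det_orthogonal_ne_zero R
    have h1 : (orthogonalReflection hn * R).1.det = -R.1.det := by
      change ((orthogonalReflection hn).1 * R.1).det = _
      rw [det_mul, det_orthogonalReflection, neg_one_mul]
    change ¬ 0 < R.1.det ↔ 0 < (orthogonalReflection hn * R).1.det
    rw [h1, not_lt, neg_pos]
    exact ⟨fun h => lt_of_le_of_ne h h0, le_of_lt⟩
  have h := measure_add_measure_compl (μ := μO) hopen
  rw [hcompl, measure_preimage_mul, measure_univ, ← two_mul] at h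
  rw [range_specialOrthogonalInclusion]
  exact ENNReal.eq_inv_of_mul_eq_one_left (by rw [mul_comm]; exact h)

theorem comap_specialOrthogonalInclusion (hn : 1 ≤ n) (μO : Measure (OGroup n))
    [μO.IsHaarMeasure] [IsProbabilityMeasure μO] (μSO : Measure (SOGroup n))
    [μSO.IsHaarMeasure] [IsProbabilityMeasure μSO] :
    μO.comap (specialOrthogonalInclusion n) = (2⁻¹ : ℝ≥0∞) • μSO := by
  have hemb := isOpenEmbedding_specialOrthogonalInclusion (n := n)
  have := Measure.IsHaarMeasure.comap (mH := inferInstance) μO hemb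
  have h := Measure.isMulInvariant_eq_smul_of_compactSpace
    (μO.comap (specialOrthogonalInclusion n)) μSO
  have h1 : ∀ s, μO.comap (specialOrthogonalInclusion n) s = Measure.haarScalarFactor
      (μO.comap (specialOrthogonalInclusion n)) μSO * μSO s :=
    fun s => congrArg (fun μ => μ s) h
  have h2 := h1 Set.univ
  rw [hemb.measurableEmbedding.comap_apply, Set.image_univ,
    measure_range_specialOrthogonalInclusion hn, measure_univ, mul_one] at h2
  ext s
  rw [h1 s, ← h2]
  rfl

theorem polarMapPos_val (S : SPD n) (R : SOGroup n) :
    (polarMapPos n (S, R)).1 = polarMap n (S, specialOrthogonalInclusion n R) := rfl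

theorem det_polarMap (S : SPD n) (R : OGroup n) :
    (polarMap n (S, R)).1.det = S.sqrt.1.det * R.1.det := by
  rw [polarMap_val, det_mul]

theorem polarMap_mem_glPos_iff (S : SPD n) (R : OGroup n) :
    polarMap n (S, R) ∈ Matrix.GLPos (Fin n) ℝ ↔
      R ∈ Set.range (specialOrthogonalInclusion n) := by
  rw [range_specialOrthogonalInclusion]
  change 0 < (polarMap n (S, R)).1.det ↔ 0 < R.1.det
  rw [det_polarMap, mul_pos_iff_of_pos_left S.sqrt.2.det_pos]

theorem bijective_polarMapPos : Function.Bijective (polarMapPos n) := by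
  constructor
  · rintro ⟨S, R⟩ ⟨T, Q⟩ h
    have h1 := bijective_polarMap.1 (congrArg Subtype.val h)
    have h2 : S = T := congrArg Prod.fst h1
    have h3 : R = Q := isOpenEmbedding_specialOrthogonalInclusion.injective
      (congrArg Prod.snd h1)
    rw [h2, h3]
  · rintro ⟨A, hA⟩
    obtain ⟨⟨S, R⟩, rfl⟩ := bijective_polarMap.2 A
    obtain ⟨Q, rfl⟩ := (polarMap_mem_glPos_iff S R).1 hA
    exact ⟨(S, Q), rfl⟩

theorem measurable_polarMapPos : Measurable (polarMapPos n) := by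
  refine Measurable.subtype_mk (f := fun p : SPD n × SOGroup n =>
    polarMap n (p.1, specialOrthogonalInclusion n p.2)) ?_
  exact measurable_polarMap.comp (measurable_fst.prodMk
    (isOpenEmbedding_specialOrthogonalInclusion.measurableEmbedding.measurable.comp
      measurable_snd))

theorem measurePreserving_polarMapPos (hn : 1 ≤ n) (μO : Measure (OGroup n))
    [μO.IsHaarMeasure] [IsProbabilityMeasure μO] (μSO : Measure (SOGroup n))
    [μSO.IsHaarMeasure] [IsProbabilityMeasure μSO] :
    MeasurePreserving (polarMapPos n) ((polarConstant n / 2) • (spdMeasure n).prod μSO)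
      (glPosHaar n) := by
  have hemb := (isOpenEmbedding_specialOrthogonalInclusion (n := n)).measurableEmbedding
  have hval := (isOpenEmbedding_glPosVal (n := n)).measurableEmbedding
  refine ⟨measurable_polarMapPos, ?_⟩
  ext E hE
  set D := polarMap n ⁻¹' (Subtype.val '' E)
  have hD : MeasurableSet D := measurable_polarMap (hval.measurableSet_image.2 hE)
  have hpre : polarMapPos n ⁻¹' E = Prod.map id (specialOrthogonalInclusion n) ⁻¹' D := by
    ext ⟨S, R⟩
    change _ ↔ polarMap n (S, specialOrthogonalInclusion n R) ∈ Subtype.val '' E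
    rw [← polarMapPos_val, Subtype.val_injective.mem_set_image]
    rfl
  -- $\det S^{1/2}>0$, so everything that maps into $GL^+(n)$ already lies over $SO(n)$, and
  -- restricting $\mu_{O(n)}$ to $SO(n)$ loses nothing of `D`.
  have hDsub : D ∩ Set.univ ×ˢ Set.range (specialOrthogonalInclusion n) = D := by
    refine Set.inter_eq_left.2 ?_
    rintro ⟨S, R⟩ ⟨A, _, hA⟩
    exact ⟨trivial, (polarMap_mem_glPos_iff S R).1 (hA ▸ A.2)⟩
  have h1 : (2⁻¹ : ℝ≥0∞) * (spdMeasure n).prod μSO (polarMapPos n ⁻¹' E)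
      = (spdMeasure n).prod μO D := by
    rw [← smul_eq_mul, ← Measure.smul_apply, ← Measure.prod_smul_right,
      ← comap_specialOrthogonalInclusion hn μO μSO, hpre,
      ← Measure.map_apply (measurable_id.prodMap hemb.measurable) hD]
    have : SFinite (μO.comap (specialOrthogonalInclusion n)) := by
      rw [comap_specialOrthogonalInclusion hn μO μSO]
      infer_instance
    rw [← Measure.map_prod_map _ _ measurable_id hemb.measurable, Measure.map_id,
      hemb.map_comap]
    conv_lhs => rw [← Measure.restrict_univ (μ := spdMeasure n)]
    rw [Measure.prod_restrict, Measure.restrict_apply hD, hDsub]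
  rw [Measure.map_apply measurable_polarMapPos hE, Measure.smul_apply, smul_eq_mul,
    ENNReal.div_eq_inv_mul, mul_right_comm, h1, glPosHaar, hval.comap_apply,
    ← (measurePreserving_polarMap μO).measure_preimage
      (hval.measurableSet_image.2 hE).nullMeasurableSet, Measure.smul_apply, smul_eq_mul, mul_comm]

theorem integral_glPosHaar (hn : 1 ≤ n) (μO : Measure (OGroup n))
    [μO.IsHaarMeasure] [IsProbabilityMeasure μO] (μSO : Measure (SOGroup n))
    [μSO.IsHaarMeasure] [IsProbabilityMeasure μSO] {f : Matrix.GLPos (Fin n) ℝ → ℝ}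
    (hf : Continuous f) (hf' : HasCompactSupport f) :
    Integrable f (glPosHaar n) ∧
      Integrable (fun p => f (polarMapPos n p)) ((spdMeasure n).prod μSO) ∧
      ∫ A, f A ∂(glPosHaar n) =
        (polarConstant n / 2).toReal *
          ∫ S, ∫ R, f (polarMapPos n (S, R)) ∂μSO ∂(spdMeasure n) := by
  have := isHaarMeasure_glPosHaar (n := n)
  have hMP := measurePreserving_polarMapPos hn μO μSO
  have h1 : Integrable f (glPosHaar n) := hf.integrable_of_hasCompactSupport hf'
  have h2 : Integrable (fun p => f (polarMapPos n p)) ((spdMeasure n).prod μSO) := by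
    have h := hMP.integrable_comp_of_integrable h1
    exact (integrable_smul_measure
      (ENNReal.div_pos polarConstant_ne_zero ENNReal.ofNat_ne_top).ne'
      (ENNReal.div_ne_top polarConstant_ne_top two_ne_zero)).1 h
  refine ⟨h1, h2, ?_⟩
  rw [← integral_prod _ h2, ← smul_eq_mul, ← integral_smul_measure, ← hMP.map_eq,
    integral_map hMP.measurable.aemeasurable]
  rw [hMP.map_eq]
  exact h1.aestronglyMeasurable

end SpecialOrthogonal

end PolarMeasure

theorem theorem3 (n : ℕ) (hn : 1 ≤ n)
    (μO : Measure (OGroup n)) [μO.IsHaarMeasure] [IsProbabilityMeasure μO]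
    (μSO : Measure (SOGroup n)) [μSO.IsHaarMeasure] [IsProbabilityMeasure μSO] :
    -- `|det A|⁻ⁿ dA` is a Haar measure, `μ_SPD` is invariant under `GL(n, ℝ)`
    (glHaar n).IsHaarMeasure ∧ (glPosHaar n).IsHaarMeasure ∧
    (∀ A : GL (Fin n) ℝ, MeasurePreserving (spdAct A) (spdMeasure n) (spdMeasure n)) ∧
    -- every `A` is uniquely `S^{1/2} R`, and `dμ_G(A) = β_n dμ_SPD(S) dμ_O(R)`
    Function.Bijective (polarMap n) ∧
    MeasurePreserving (polarMap n) (polarConstant n • (spdMeasure n).prod μO) (glHaar n) ∧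
    -- the integral over `GL⁺(n, ℝ)`
    Function.Bijective (polarMapPos n) ∧
    ∀ f : Matrix.GLPos (Fin n) ℝ → ℝ, Continuous f → HasCompactSupport f →
      Integrable f (glPosHaar n) ∧
      Integrable (fun p => f (polarMapPos n p)) ((spdMeasure n).prod μSO) ∧
      ∫ A, f A ∂(glPosHaar n) =
        (polarConstant n / 2).toReal *
          ∫ S, ∫ R, f (polarMapPos n (S, R)) ∂μSO ∂(spdMeasure n) := by
  exact ⟨isHaarMeasure_glHaar, isHaarMeasure_glPosHaar, measurePreserving_spdAct,
    bijective_polarMap, measurePreserving_polarMap μO, bijective_polarMapPos,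
    fun f hf hf' => integral_glPosHaar hn μO μSO hf hf'⟩
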